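/- Let $N\ge 1$, $0<\beta<1$ and $p,q>0$ with $$2<p+q\le 2+\frac{2(1-\beta)}{N+\beta}.$$ Let $K\in C(\mathbb R^N\setminus\{0\})$ satisfy $K>0$, $\liminf_{x\to0}K(x)>0$ and, for some constants $\rho,c>0$, $K(x)\ge c|x|^{-\beta}$ whenever $|x|>\rho$. Put $(K*u^p)(x,t)=\int_{\mathbb R^N}K(x-y)\,u(y,t)^p\,dy\in[0,\infty]$ for $u\ge 0$ and $\mathcal A(\xi)=\xi/\sqrt{1+|\xi|^2}$ for $\xi\in\mathbb R^N$. Then the problem $$u_t-\operatorname{div}\Big(\frac{\nabla u}{\sqrt{1+|\nabla u|^2}}\Big)\ge (K*u^p)\,u^q\ \text{ in }\mathbb R^N\times(0,\infty),\qquad u(x,0)=u_0(x)\ge0\ \text{ in }\mathbb R^N,$$ with $u_0\in L^1_{\rm loc}(\mathbb R^N)$, has no nonnegative nontrivial weak solution (nontrivial: not almost everywhere $0$ in $\mathbb R^N\times(0,\infty)$). Here a nonnegative weak solution is a function $u\ge0$ (a.e.) in $W^{1,2}_{\rm loc}(\mathbb R^N\times(0,\infty))$ with $\mathcal A(\nabla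 u)\in L^2_{\rm loc}(\mathbb R^N\times(0,\infty))^N$ and $(K*u^p)u^q\in L^1_{\rm loc}(\mathbb R^N\times(0,\infty))$ such that for every nonnegative $\varphi\in C^1_c(\mathbb R^N\times\mathbb R)$ the integrals on the right converge and $$\int_0^\infty\!\!\int_{\mathbb R^N}(K*u^p)u^q\varphi\,dx\,dt\le\int_0^\infty\!\!\int_{\mathbb R^N}u_t\,\varphi\,dx\,dt+\int_0^\infty\!\!\int_{\mathbb R^N}\mathcal A(\nabla u)\cdot\nabla\varphi\,dx\,dt$$ (in this form the initial datum is the trace of $u$ at $t=0$). The same nonexistence holds if this inequality is replaced by the one that displays the initial datum, $$\int_0^\infty\!\!\int_{\mathbb R^N}(K*u^p)u^q\varphi\,dx\,dt\le-\int_{\mathbb R^N}u_0(x)\varphi(x,0)\,dx-\int_0^\infty\!\!\int_{\mathbb R^N}u\,\varphi_t\,dx\,dt+\int_0^\infty\!\!\int_{\mathbb R^N}\mathcal A(\nabla u)\cdot\nabla\varphi\,dx\,dt ,$$ for some nonnegative $u_0\in L^1_{\rm loc}(\mathbb R^N)$. -/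

import Mathlib

open MeasureTheory Filter Topology Set
open scoped ENNReal ContDiff

/-- The spatial domain `ℝ^N`, with its Euclidean norm. -/
abbrev Space (N : ℕ) : Type := EuclideanSpace ℝ (Fin N)

/-- Space-time `ℝ^N × ℝ`; a point is `z = (x, t)`. -/
abbrev SpaceTime (N : ℕ) : Type := Space N × ℝ

/-- The open half space `ℝ^N × (0, ∞)`. -/
def halfSpace (N : ℕ) : Set (SpaceTime N) := univ ×ˢ Ioi (0 : ℝ)

/-- `f ∈ L^r_loc(ℝ^N × (0, ∞))`: `f` is in `L^r` on every compact subset of the open half space. -/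
def MemLrLoc {N : ℕ} {F : Type*} [NormedAddCommGroup F] (r : ℝ) (f : SpaceTime N → F) : Prop :=
  ∀ C : Set (SpaceTime N), IsCompact C → C ⊆ halfSpace N →
    MemLp f (ENNReal.ofReal r) (volume.restrict C)

/-- The (classical) gradient in the space variable `x`. -/
noncomputable def spaceGrad {N : ℕ} (φ : SpaceTime N → ℝ) (z : SpaceTime N) : Space N :=
  gradient (fun x : Space N => φ (x, z.2)) z.1

/-- The (classical) derivative in the time variable `t`. -/
noncomputable def timeDeriv {N : ℕ} (φ : SpaceTime N → ℝ) (z : SpaceTime N) : ℝ :=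
  deriv (fun t : ℝ => φ (z.1, t)) z.2

/-- `φ ∈ C^∞_c(ℝ^N × (0, ∞))`: the test functions that define weak derivatives. -/
structure IsInteriorTest {N : ℕ} (φ : SpaceTime N → ℝ) : Prop where
  smooth : ContDiff ℝ ∞ φ
  compact : HasCompactSupport φ
  support_subset : tsupport φ ⊆ halfSpace N

/-- `u ∈ W^{1,m}_loc(ℝ^N × (0, ∞))` with weak time derivative `ut` and weak spatial gradient
`Du`. -/
structure IsSobolevLoc {N : ℕ} (m : ℝ) (u ut : SpaceTime N → ℝ) (Du : SpaceTime N → Space N) :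
    Prop where
  memLr : MemLrLoc m u
  memLr_time : MemLrLoc m ut
  memLr_space : MemLrLoc m Du
  weak_time : ∀ φ : SpaceTime N → ℝ, IsInteriorTest φ →
    ∫ z in halfSpace N, u z * timeDeriv φ z = -∫ z in halfSpace N, ut z * φ z
  weak_space : ∀ φ : SpaceTime N → ℝ, IsInteriorTest φ →
    ∫ z in halfSpace N, u z • spaceGrad φ z = -∫ z in halfSpace N, φ z • Du z

/-- Nonnegative functions in `C^1_c(ℝ^N × ℝ)`. They need not vanish at `t = 0`. -/
structure IsTest {N : ℕ} (φ : SpaceTime N → ℝ) : Prop where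
  contDiff : ContDiff ℝ 1 φ
  compact : HasCompactSupport φ
  nonneg : ∀ z, 0 ≤ φ z

/-- The standing assumptions on the convolution weight `K`; its value at `0` is irrelevant.
The lower limit is taken in the extended reals, so that it may be `+∞`. -/
structure IsAdmissibleKernel {N : ℕ} (β : ℝ) (K : Space N → ℝ) : Prop where
  continuousOn : ContinuousOn K {0}ᶜ
  pos : ∀ x, x ≠ 0 → 0 < K x
  liminf_pos : 0 < liminf (fun x => (K x : EReal)) (𝓝[≠] (0 : Space N))
  lower_bound : ∃ ρ > (0 : ℝ), ∃ c > (0 : ℝ), ∀ x, ρ < ‖x‖ → c * ‖x‖ ^ (-β) ≤ K x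

/-- `(K ∗ u^p)(x, t) = ∫ K(x - y) u(y, t)^p dy`, the integral of a nonnegative function,
with values in `[0, ∞]`. -/
noncomputable def convPow {N : ℕ} (K : Space N → ℝ) (p : ℝ) (u : SpaceTime N → ℝ)
    (z : SpaceTime N) : ℝ≥0∞ :=
  ∫⁻ y : Space N, ENNReal.ofReal (K (z.1 - y) * u (y, z.2) ^ p)

/-- The nonlocal source `(K ∗ u^p) u^q`, with values in `[0, ∞]`. -/
noncomputable def source {N : ℕ} (K : Space N → ℝ) (p q : ℝ) (u : SpaceTime N → ℝ)
    (z : SpaceTime N) : ℝ≥0∞ :=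
  convPow K p u z * ENNReal.ofReal (u z ^ q)

/-- The mean curvature operator `𝒜(x, s, ξ) = ξ / √(1 + |ξ|²)`. -/
noncomputable def meanCurvature {N : ℕ} (_x : Space N) (_s : ℝ) (ξ : Space N) : Space N :=
  (1 / Real.sqrt (1 + ‖ξ‖ ^ 2)) • ξ

/-- A nonnegative function `u` of class `𝒮`: `u ∈ W^{1,m}_loc`, `𝒜(x, u, ∇u) ∈ L^{m'}_loc` with
`m' = m / (m - 1)`, and `(K ∗ u^p) u^q ∈ L^1_loc`, all on `ℝ^N × (0, ∞)`. -/
structure IsNonnegClassS {N : ℕ} (𝒜 : Space N → ℝ → Space N → Space N) (m : ℝ)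
    (K : Space N → ℝ) (p q : ℝ) (u ut : SpaceTime N → ℝ) (Du : SpaceTime N → Space N) :
    Prop where
  nonneg : ∀ᵐ z ∂(volume.restrict (halfSpace N)), 0 ≤ u z
  sobolev : IsSobolevLoc m u ut Du
  flux : MemLrLoc (m / (m - 1)) (fun z => 𝒜 z.1 (u z) (Du z))
  source_loc : ∀ C : Set (SpaceTime N), IsCompact C → C ⊆ halfSpace N →
    ∫⁻ z in C, source K p q u z < ⊤

/-- Nonnegative weak solution of `u_t - div 𝒜(x, u, ∇u) ≥ (K ∗ u^p) u^q` in `ℝ^N × (0, ∞)`: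
for all nonnegative `φ ∈ C^1_c(ℝ^N × ℝ)`,
`∬ (K ∗ u^p) u^q φ ≤ ∬ u_t φ + ∬ 𝒜(x, u, ∇u) · ∇φ`, with convergent integrals on the right.
The test functions reach `t = 0`; the initial datum is the trace of `u`, on which this form of
the problem puts no condition. -/
def IsNonnegWeakSolution {N : ℕ} (𝒜 : Space N → ℝ → Space N → Space N) (m : ℝ)
    (K : Space N → ℝ) (p q : ℝ) (u : SpaceTime N → ℝ) : Prop :=
  ∃ (ut : SpaceTime N → ℝ) (Du : SpaceTime N → Space N),
    IsNonnegClassS 𝒜 m K p q u ut Du ∧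
    ∀ φ : SpaceTime N → ℝ, IsTest φ →
      IntegrableOn (fun z => ut z * φ z) (halfSpace N) ∧
      IntegrableOn (fun z => inner ℝ (𝒜 z.1 (u z) (Du z)) (spaceGrad φ z)) (halfSpace N) ∧
      ((∫⁻ z in halfSpace N, source K p q u z * ENNReal.ofReal (φ z) : ℝ≥0∞) : EReal) ≤
        (((∫ z in halfSpace N, ut z * φ z) +
          ∫ z in halfSpace N, inner ℝ (𝒜 z.1 (u z) (Du z)) (spaceGrad φ z) : ℝ) : EReal)

/-- Nonnegative weak solution of `u_t - div 𝒜(x, u, ∇u) ≥ (K ∗ u^p) u^q` in `ℝ^N × (0, ∞)`,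
`u(x, 0) = u₀(x)`, with the time derivative moved to the test function: for all nonnegative
`φ ∈ C^1_c(ℝ^N × ℝ)`,
`∬ (K ∗ u^p) u^q φ ≤ - ∫ u₀ φ(·, 0) - ∬ u φ_t + ∬ 𝒜(x, u, ∇u) · ∇φ`,
with convergent integrals on the right. -/
def IsNonnegWeakSolutionWithDatum {N : ℕ} (𝒜 : Space N → ℝ → Space N → Space N) (m : ℝ)
    (K : Space N → ℝ) (p q : ℝ) (u₀ : Space N → ℝ) (u : SpaceTime N → ℝ) : Prop :=
  ∃ (ut : SpaceTime N → ℝ) (Du : SpaceTime N → Space N),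
    IsNonnegClassS 𝒜 m K p q u ut Du ∧
    ∀ φ : SpaceTime N → ℝ, IsTest φ →
      IntegrableOn (fun z => u z * timeDeriv φ z) (halfSpace N) ∧
      IntegrableOn (fun z => inner ℝ (𝒜 z.1 (u z) (Du z)) (spaceGrad φ z)) (halfSpace N) ∧
      ((∫⁻ z in halfSpace N, source K p q u z * ENNReal.ofReal (φ z) : ℝ≥0∞) : EReal) ≤
        ((-(∫ x : Space N, u₀ x * φ (x, 0)) - (∫ z in halfSpace N, u z * timeDeriv φ z) +
          ∫ z in halfSpace N, inner ℝ (𝒜 z.1 (u z) (Du z)) (spaceGrad φ z) : ℝ) : EReal)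

/-- `u` does not vanish almost everywhere in `ℝ^N × (0, ∞)`. -/
def IsNontrivial {N : ℕ} (u : SpaceTime N → ℝ) : Prop :=
  ¬ ∀ᵐ z ∂(volume.restrict (halfSpace N)), u z = 0

/-! The proof is a nonlinear capacity argument. Put `σ = (p + q) / 2`; the assumption on `p + q`
says `1 < σ ≤ (N + 1) / (N + β)`. Write `G = 𝒜(∇u)`. Besides measurability, only `|G| ≤ 1` and `|G|²
≤ G · ∇u` are used about the operator.

Test with `h(u) ψ`, where `h(s) = 1 + (1 + s/m)^(-α)`, `0 < α < 1`, `m > 0` is a free scale and `ψ =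
η^(j+2)` is a power of a parabolic cut-off at radius `R`. The summand `1` keeps the whole source.
The decreasing summand produces `-|h'(u)| ψ |G|²`, which absorbs `h(u) G · ∇ψ` by completing the
square, at the cost of `m R⁻² (1 + u/m)^(1+α) η^j`. The time term has the same cost: the primitive
`H` of `h` is nonnegative and at most a multiple of `m (1 + s/m)^(1+α)`. The initial ramp of the
cut-off increases in time, so its contribution has a favourable sign and is dropped. Hence neither
the initial datum nor the ramp enters the estimates.

Let `X` be the integral over time of `(∫ u^σ ψ dx)²`, and let `Y` be its part over the shell `R² ≤
|x|² + t ≤ 2R²`. Two points of the support are at distance at most `4R`, where `K ≥ c R^(-β)`, so by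
Cauchy–Schwarz in `x` the source is at least `c R^(-β) X`. With `1 + α ≤ σ` and Cauchy–Schwarz in
`t`, the right-hand side is at most `C R^N m` as soon as `Y ≤ (R^(N+1) m^σ)²`
(`exists_capacity_bound`). The choice `m = y R^(-(N+1)/σ)` gives: `Y ≤ y^(2σ)` implies `X ≤ C y R^(N
+ β - (N+1)/σ) ≤ C y`, the critical exponent included (`IsInteriorSolution.exists_energy_bound`).

As `Y ≤ X`, this bounds `X` uniformly in `R`. The limit energy is thus finite, so `Y → 0` as `R →
∞`, and the same implication with arbitrarily small `y` gives `X = 0` in the limit. -/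

section

open scoped Convolution

variable {N : ℕ}

/-! ### Convergence of mollifications in the mean -/

/-- A form of the dominated convergence theorem with varying dominating functions whose integrals
are constant. -/
theorem tendsto_lintegral_enorm_sub_of_dominated_varying {α E : Type*} [MeasurableSpace α]
    {μ : Measure α} [NormedAddCommGroup E] {F : ℕ → α → E} {f : α → E} {g : ℕ → α → ℝ≥0∞}
    (hF : ∀ n, AEStronglyMeasurable (F n) μ) (hf : AEStronglyMeasurable f μ)
    (hg : ∀ n, AEMeasurable (g n) μ) (hFg : ∀ n, ∀ᵐ x ∂μ, ‖F n x‖ₑ ≤ g n x)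
    (hlim : ∀ᵐ x ∂μ, Tendsto (fun n => F n x) atTop (𝓝 (f x)))
    (hglim : ∀ᵐ x ∂μ, Tendsto (fun n => g n x) atTop (𝓝 ‖f x‖ₑ))
    (hint : ∀ n, ∫⁻ x, g n x ∂μ = ∫⁻ x, ‖f x‖ₑ ∂μ) (hfin : ∫⁻ x, ‖f x‖ₑ ∂μ ≠ ⊤) :
    Tendsto (fun n => ∫⁻ x, ‖F n x - f x‖ₑ ∂μ) atTop (𝓝 0) := by
  set I := ∫⁻ x, ‖f x‖ₑ ∂μ with hI
  have hle : ∀ n, ∀ᵐ x ∂μ, ‖F n x - f x‖ₑ ≤ g n x + ‖f x‖ₑ := fun n => by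
    filter_upwards [hFg n] with x hx
    exact (enorm_sub_le).trans (by gcongr)
  have hsum : ∀ n, ∫⁻ x, (g n x + ‖f x‖ₑ) ∂μ = I + I := fun n => by
    rw [lintegral_add_left' (hg n), hint n]
  have hEle : ∀ n, ∫⁻ x, ‖F n x - f x‖ₑ ∂μ ≤ I + I := fun n =>
    (lintegral_mono_ae (hle n)).trans (hsum n).le
  have hII : I + I ≠ ⊤ := ENNReal.add_ne_top.2 ⟨hfin, hfin⟩
  have hsub : ∀ n, ∫⁻ x, (g n x + ‖f x‖ₑ - ‖F n x - f x‖ₑ) ∂μ =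
      I + I - ∫⁻ x, ‖F n x - f x‖ₑ ∂μ := fun n => by
    have hm : AEMeasurable (fun x => ‖F n x - f x‖ₑ) μ := ((hF n).sub hf).enorm
    rw [lintegral_sub' hm (ne_top_of_le_ne_top hII (hEle n)) (hle n), hsum n]
  -- Fatou's lemma for the nonnegative functions `g n + ‖f‖ - ‖F n - f‖`, which tend to `2‖f‖` and
  -- have integral `2I - ∫ ‖F n - f‖`.
  have hfatou : I + I ≤ liminf (fun n => I + I - ∫⁻ x, ‖F n x - f x‖ₑ ∂μ) atTop := by
    calc I + I = ∫⁻ x, (‖f x‖ₑ + ‖f x‖ₑ) ∂μ := by rw [lintegral_add_left' hf.enorm]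
      _ = ∫⁻ x, liminf (fun n => g n x + ‖f x‖ₑ - ‖F n x - f x‖ₑ) atTop ∂μ := by
        refine lintegral_congr_ae ?_
        filter_upwards [hlim, hglim] with x h1 h2
        have h3 : Tendsto (fun n => ‖F n x - f x‖ₑ) atTop (𝓝 0) := by
          have := (h1.sub_const (f x)).enorm
          simpa using this
        have h4 : Tendsto (fun n => g n x + ‖f x‖ₑ - ‖F n x - f x‖ₑ) atTop
            (𝓝 (‖f x‖ₑ + ‖f x‖ₑ - 0)) :=
          ENNReal.Tendsto.sub (h2.add_const _) h3 (Or.inr ENNReal.zero_ne_top)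
        rw [tsub_zero] at h4
        exact h4.liminf_eq.symm
      _ ≤ liminf (fun n => ∫⁻ x, (g n x + ‖f x‖ₑ - ‖F n x - f x‖ₑ) ∂μ) atTop :=
        lintegral_liminf_le' fun n => ((hg n).add hf.enorm).sub ((hF n).sub hf).enorm
      _ = _ := by simp_rw [hsub]
  rw [ENNReal.tendsto_nhds_zero]
  intro ε hε
  by_cases hI0 : I + I = 0
  · exact Eventually.of_forall fun n => (hEle n).trans (by simp [hI0])
  · have hlt : I + I - ε < I + I := ENNReal.sub_lt_self hII hI0 hε.ne'
    filter_upwards [eventually_lt_of_lt_liminf (hlt.trans_le hfatou)] with n hn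
    by_contra! hcon
    exact (tsub_le_tsub_left hcon.le (I + I)).not_gt hn

/-- Mollifications of an integrable function converge to it in mean. -/
theorem tendsto_lintegral_enorm_convolution_sub {G E : Type*} [NormedAddCommGroup G]
    [NormedSpace ℝ G] [FiniteDimensional ℝ G] [MeasurableSpace G] [BorelSpace G]
    {μ : Measure G} [μ.IsAddHaarMeasure] [NormedAddCommGroup E] [NormedSpace ℝ E]
    [CompleteSpace E] {φ : ℕ → ContDiffBump (0 : G)} {K : ℝ} {f : G → E}
    (hφ : Tendsto (fun i => (φ i).rOut) atTop (𝓝 0))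
    (h'φ : ∀ᶠ i in atTop, (φ i).rOut ≤ K * (φ i).rIn) (hf : Integrable f μ) :
    Tendsto (fun n => ∫⁻ x, ‖((φ n).normed μ ⋆[ContinuousLinearMap.lsmul ℝ ℝ, μ] f) x - f x‖ₑ ∂μ)
      atTop (𝓝 0) := by
  have hni : ∀ n, Integrable ((φ n).normed μ) μ := fun n => (φ n).integrable_normed
  have hcn : ∀ n, Integrable
      ((φ n).normed μ ⋆[ContinuousLinearMap.lsmul ℝ ℝ, μ] fun x => ‖f x‖) μ := fun n =>
    (hni n).integrable_convolution _ hf.norm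
  -- The majorants are the mollifications of `‖f‖`; they keep its integral because the kernel has
  -- mass one.
  refine tendsto_lintegral_enorm_sub_of_dominated_varying
    (g := fun n x => ENNReal.ofReal
      (((φ n).normed μ ⋆[ContinuousLinearMap.lsmul ℝ ℝ, μ] fun x => ‖f x‖) x)) ?_
    hf.aestronglyMeasurable ?_ ?_ ?_ ?_ ?_ hf.hasFiniteIntegral.ne
  · exact fun n => ((hni n).integrable_convolution _ hf).aestronglyMeasurable
  · exact fun n => (hcn n).aestronglyMeasurable.aemeasurable.ennreal_ofReal
  · refine fun n => Eventually.of_forall fun x => ?_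
    rw [← ofReal_norm]
    refine ENNReal.ofReal_le_ofReal ?_
    simp only [convolution, ContinuousLinearMap.lsmul_apply]
    refine (norm_integral_le_integral_norm _).trans_eq ?_
    refine integral_congr_ae (Eventually.of_forall fun t => ?_)
    simp [norm_smul, abs_of_nonneg ((φ n).nonneg_normed t)]
  · exact ContDiffBump.ae_convolution_tendsto_right_of_locallyIntegrable hφ h'φ
      hf.locallyIntegrable
  · filter_upwards [ContDiffBump.ae_convolution_tendsto_right_of_locallyIntegrable hφ h'φ
      hf.norm.locallyIntegrable] with x hx
    rw [← ofReal_norm]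
    exact ENNReal.tendsto_ofReal hx
  · intro n
    rw [← ofReal_integral_eq_lintegral_ofReal (hcn n), integral_convolution _ (hni n) hf.norm,
      (φ n).integral_normed, ← ofReal_integral_norm_eq_lintegral_enorm hf]
    · simp
    · refine Eventually.of_forall fun x => ?_
      simp only [convolution, ContinuousLinearMap.lsmul_apply]
      exact integral_nonneg fun t => smul_nonneg ((φ n).nonneg_normed t) (norm_nonneg _)


/-! ### Classical derivatives and smooth approximation of Sobolev functions -/

theorem hasDerivAt_time {φ : SpaceTime N → ℝ} {z : SpaceTime N} (h : DifferentiableAt ℝ φ z) :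
    HasDerivAt (fun t : ℝ => φ (z.1, t)) (fderiv ℝ φ z (0, 1)) z.2 := by
  have h1 : HasFDerivAt φ (fderiv ℝ φ z) (z.1, z.2) := h.hasFDerivAt
  exact h1.comp_hasDerivAt z.2 ((hasDerivAt_const z.2 z.1).prodMk (hasDerivAt_id z.2))

theorem timeDeriv_eq_fderiv {φ : SpaceTime N → ℝ} {z : SpaceTime N}
    (h : DifferentiableAt ℝ φ z) : timeDeriv φ z = fderiv ℝ φ z (0, 1) :=
  (hasDerivAt_time h).deriv

theorem inner_spaceGrad_eq_fderiv {φ : SpaceTime N → ℝ} {z : SpaceTime N}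
    (h : DifferentiableAt ℝ φ z) (v : Space N) :
    inner ℝ (spaceGrad φ z) v = fderiv ℝ φ z (v, 0) := by
  have h1 : HasFDerivAt φ (fderiv ℝ φ z) (z.1, z.2) := h.hasFDerivAt
  have h2 : HasFDerivAt (fun x : Space N => φ (x, z.2))
      ((fderiv ℝ φ z).comp ((ContinuousLinearMap.id ℝ (Space N)).prod 0)) z.1 :=
    h1.comp z.1 ((hasFDerivAt_id z.1).prodMk (hasFDerivAt_const z.2 z.1))
  rw [spaceGrad, gradient, h2.fderiv, InnerProductSpace.toDual_symm_apply]
  simp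

theorem spaceGrad_eq_iff {φ : SpaceTime N → ℝ} {z : SpaceTime N}
    (h : DifferentiableAt ℝ φ z) {ξ : Space N} :
    spaceGrad φ z = ξ ↔ ∀ v, fderiv ℝ φ z (v, 0) = inner ℝ ξ v := by
  constructor
  · rintro rfl v
    exact (inner_spaceGrad_eq_fderiv h v).symm
  · intro H
    refine ext_inner_right ℝ fun v => ?_
    rw [inner_spaceGrad_eq_fderiv h, H]

theorem continuous_timeDeriv {φ : SpaceTime N → ℝ} (h : ContDiff ℝ 1 φ) :
    Continuous (timeDeriv φ) := by
  have : timeDeriv φ = fun z => fderiv ℝ φ z (0, 1) :=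
    funext fun z => timeDeriv_eq_fderiv (h.differentiable one_ne_zero z)
  rw [this]
  exact (h.continuous_fderiv one_ne_zero).clm_apply continuous_const

theorem continuous_spaceGrad {φ : SpaceTime N → ℝ} (h : ContDiff ℝ 1 φ) :
    Continuous (spaceGrad φ) := by
  have : spaceGrad φ = fun z => (InnerProductSpace.toDual ℝ (Space N)).symm
      ((fderiv ℝ φ z).comp ((ContinuousLinearMap.id ℝ (Space N)).prod 0)) := by
    funext z
    rw [spaceGrad_eq_iff (h.differentiable one_ne_zero z)]
    intro v
    rw [InnerProductSpace.toDual_symm_apply]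
    simp
  rw [this]
  exact (LinearIsometryEquiv.continuous _).comp
    ((h.continuous_fderiv one_ne_zero).clm_comp continuous_const)

theorem timeDeriv_eq_zero_of_notMem_tsupport {φ : SpaceTime N → ℝ} {z : SpaceTime N}
    (hz : z ∉ tsupport φ) : timeDeriv φ z = 0 := by
  have h : φ =ᶠ[𝓝 z] fun _ => 0 := notMem_tsupport_iff_eventuallyEq.1 hz
  have hd : DifferentiableAt ℝ φ z := h.differentiableAt_iff.2 (differentiableAt_const _)
  rw [timeDeriv_eq_fderiv hd, h.fderiv_eq]
  simp

theorem spaceGrad_eq_zero_of_notMem_tsupport {φ : SpaceTime N → ℝ} {z : SpaceTime N}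
    (hz : z ∉ tsupport φ) : spaceGrad φ z = 0 := by
  have h : φ =ᶠ[𝓝 z] fun _ => 0 := notMem_tsupport_iff_eventuallyEq.1 hz
  have hd : DifferentiableAt ℝ φ z := h.differentiableAt_iff.2 (differentiableAt_const _)
  rw [spaceGrad_eq_iff hd, h.fderiv_eq]
  simp

theorem isOpen_halfSpace : IsOpen (halfSpace N) := isOpen_univ.prod isOpen_Ioi

theorem measurableSet_halfSpace : MeasurableSet (halfSpace N) := isOpen_halfSpace.measurableSet

theorem MemLrLoc.integrableOn {F : Type*} [NormedAddCommGroup F] {r : ℝ}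
    (hr : 1 ≤ r) {f : SpaceTime N → F} (hf : MemLrLoc r f) {C : Set (SpaceTime N)}
    (hC : IsCompact C) (hCh : C ⊆ halfSpace N) : IntegrableOn f C := by
  have : IsFiniteMeasure (volume.restrict C) := isFiniteMeasure_restrict.2 hC.measure_lt_top.ne
  exact (hf C hC hCh).integrable (by simpa using ENNReal.ofReal_le_ofReal hr)

instance isAddHaarMeasure_volume_spaceTime :
    (volume : Measure (SpaceTime N)).IsAddHaarMeasure :=
  Measure.prod.instIsAddHaarMeasure (volume : Measure (Space N)) (volume : Measure ℝ)

/-- The derivative falls on the kernel, so the formula becomes a weak-derivative identity tested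
with the kernel itself. -/
theorem fderiv_convolution_lsmul_apply {G : Type*} [NormedAddCommGroup G] [NormedSpace ℝ G]
    [FiniteDimensional ℝ G] [MeasurableSpace G] [BorelSpace G] {μ : Measure G} [μ.IsAddHaarMeasure]
    {ρ f : G → ℝ} (hρ : ContDiff ℝ 1 ρ) (hc : HasCompactSupport ρ) (hf : LocallyIntegrable f μ)
    (z v : G) :
    fderiv ℝ (ρ ⋆[ContinuousLinearMap.lsmul ℝ ℝ, μ] f) z v =
      ∫ w, fderiv ℝ ρ (z - w) v * f w ∂μ := by
  rw [(hc.hasFDerivAt_convolution_left (ContinuousLinearMap.lsmul ℝ ℝ) hρ hf z).fderiv,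
    convolution_eq_swap, ContinuousLinearMap.integral_apply]
  · simp [ContinuousLinearMap.precompL_apply]
  · have := (hc.fderiv ℝ).convolutionExists_left
      ((ContinuousLinearMap.lsmul ℝ ℝ).precompL G) (hρ.continuous_fderiv one_ne_zero) hf z
    exact this.integrable_swap

/-- Reflected and translated bump functions are admissible in the definition of weak
derivatives. -/
theorem isInteriorTest_bump_sub (φ : ContDiffBump (0 : SpaceTime N)) {z : SpaceTime N}
    (hz : Metric.closedBall z φ.rOut ⊆ halfSpace N) :
    IsInteriorTest (fun w => φ.normed volume (z - w)) ∧
      ∀ w, φ.normed volume (z - w) ≠ 0 → w ∈ Metric.closedBall z φ.rOut := by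
  have hsupp : ∀ w, φ.normed volume (z - w) ≠ 0 → w ∈ Metric.closedBall z φ.rOut := fun w hw => by
    have h1 : z - w ∈ Function.support (φ.normed volume) := hw
    rw [φ.support_normed_eq, mem_ball_zero_iff] at h1
    rw [Metric.mem_closedBall, dist_comm, dist_eq_norm]
    exact h1.le
  have hts : tsupport (fun w => φ.normed volume (z - w)) ⊆ Metric.closedBall z φ.rOut :=
    closure_minimal (fun w hw => hsupp w hw) Metric.isClosed_closedBall
  refine ⟨⟨φ.contDiff_normed.comp (contDiff_const.sub contDiff_id), ?_, hts.trans hz⟩, hsupp⟩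
  exact (isCompact_closedBall z φ.rOut).of_isClosed_subset (isClosed_tsupport _) hts

theorem fderiv_comp_const_sub {ρ : SpaceTime N → ℝ} (hρ : Differentiable ℝ ρ)
    (z w v : SpaceTime N) :
    fderiv ℝ (fun w => ρ (z - w)) w v = -fderiv ℝ ρ (z - w) v := by
  have h1 : HasFDerivAt (fun w : SpaceTime N => z - w) (-ContinuousLinearMap.id ℝ _) w :=
    (hasFDerivAt_id w).const_sub z
  have h2 := (hρ (z - w)).hasFDerivAt.comp w h1
  rw [show (fun w => ρ (z - w)) = ρ ∘ fun w => z - w from rfl, h2.fderiv]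
  simp

section Mollify

variable {u ut : SpaceTime N → ℝ} {Du : SpaceTime N → Space N} {C : Set (SpaceTime N)}
  {φ : ContDiffBump (0 : SpaceTime N)} {z : SpaceTime N}

theorem integral_indicator_smul_eq {F : Type*} [NormedAddCommGroup F] [NormedSpace ℝ F]
    (hCh : C ⊆ halfSpace N) {g : SpaceTime N → ℝ} {f : SpaceTime N → F}
    (hg : ∀ w, g w ≠ 0 → w ∈ C) :
    ∫ w, g w • C.indicator f w = ∫ w in halfSpace N, g w • f w := by
  rw [← setIntegral_eq_integral_of_forall_compl_eq_zero (s := halfSpace N)]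
  · refine setIntegral_congr_fun measurableSet_halfSpace fun w _ => ?_
    by_cases hw : w ∈ C
    · simp [hw]
    · have : g w = 0 := by_contra fun h => hw (hg w h)
      simp [this]
  · intro w hw
    rw [indicator_of_notMem (fun h => hw (hCh h)), smul_zero]

theorem fderiv_bump_ne_zero {v w : SpaceTime N}
    (h : fderiv ℝ (φ.normed volume) (z - w) v ≠ 0) : w ∈ Metric.closedBall z φ.rOut := by
  have h1 : z - w ∈ tsupport (φ.normed volume) := by
    refine support_fderiv_subset ℝ (f := φ.normed volume) ?_
    intro h0
    rw [h0] at h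
    exact h rfl
  rw [φ.tsupport_normed_eq, mem_closedBall_zero_iff] at h1
  rw [Metric.mem_closedBall, dist_comm, dist_eq_norm]
  exact h1

/-- The reflected kernel `w ↦ ρ(z - w)` is a test function for the weak derivative; the sign from
reflection cancels the sign from integration by parts. Since the ball around `z` lies in `C`,
truncating `u` to `C` creates no boundary term. -/
theorem timeDeriv_mollify (hu : IsSobolevLoc 2 u ut Du) (hC : IsCompact C)
    (hCh : C ⊆ halfSpace N) (hz : Metric.closedBall z φ.rOut ⊆ C) :
    timeDeriv (φ.normed volume ⋆[ContinuousLinearMap.lsmul ℝ ℝ, volume] C.indicator u) z =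
      (φ.normed volume ⋆[ContinuousLinearMap.lsmul ℝ ℝ, volume] C.indicator ut) z := by
  have hint : Integrable (C.indicator u) :=
    (hu.memLr.integrableOn one_le_two hC hCh).integrable_indicator hC.measurableSet
  have hρ : ContDiff ℝ 1 (φ.normed (volume : Measure (SpaceTime N))) := φ.contDiff_normed
  have hcd := φ.hasCompactSupport_normed.contDiff_convolution_left (n := 1)
    (ContinuousLinearMap.lsmul ℝ ℝ) hρ hint.locallyIntegrable
  obtain ⟨ht, hs⟩ := isInteriorTest_bump_sub φ (hz.trans hCh)
  rw [timeDeriv_eq_fderiv (hcd.differentiable one_ne_zero z),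
    fderiv_convolution_lsmul_apply hρ φ.hasCompactSupport_normed hint.locallyIntegrable,
    convolution_eq_swap]
  simp only [← smul_eq_mul, ContinuousLinearMap.lsmul_apply]
  rw [integral_indicator_smul_eq hCh fun w hw => hz (fderiv_bump_ne_zero hw),
    integral_indicator_smul_eq hCh fun w hw => hz (hs w hw)]
  have h := hu.weak_time _ ht
  have h2 : ∀ w, timeDeriv (fun w => φ.normed volume (z - w)) w =
      -fderiv ℝ (φ.normed volume) (z - w) (0, 1) := fun w => by
    rw [timeDeriv_eq_fderiv (ht.smooth.differentiable (by simp) w),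
      fderiv_comp_const_sub (hρ.differentiable one_ne_zero)]
  simp only [h2, mul_neg, integral_neg, neg_inj] at h
  simpa only [smul_eq_mul, mul_comm] using h

theorem spaceGrad_mollify (hu : IsSobolevLoc 2 u ut Du) (hC : IsCompact C)
    (hCh : C ⊆ halfSpace N) (hz : Metric.closedBall z φ.rOut ⊆ C) :
    spaceGrad (φ.normed volume ⋆[ContinuousLinearMap.lsmul ℝ ℝ, volume] C.indicator u) z =
      (φ.normed volume ⋆[ContinuousLinearMap.lsmul ℝ ℝ, volume] C.indicator Du) z := by
  have hint : Integrable (C.indicator u) :=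
    (hu.memLr.integrableOn one_le_two hC hCh).integrable_indicator hC.measurableSet
  have hρ : ContDiff ℝ 1 (φ.normed (volume : Measure (SpaceTime N))) := φ.contDiff_normed
  have hcd := φ.hasCompactSupport_normed.contDiff_convolution_left (n := 1)
    (ContinuousLinearMap.lsmul ℝ ℝ) hρ hint.locallyIntegrable
  obtain ⟨ht, hs⟩ := isInteriorTest_bump_sub φ (hz.trans hCh)
  rw [spaceGrad_eq_iff (hcd.differentiable one_ne_zero z)]
  intro v
  rw [fderiv_convolution_lsmul_apply hρ φ.hasCompactSupport_normed hint.locallyIntegrable,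
    convolution_eq_swap]
  simp only [← smul_eq_mul, ContinuousLinearMap.lsmul_apply]
  rw [integral_indicator_smul_eq hCh fun w hw => hz (fderiv_bump_ne_zero hw),
    integral_indicator_smul_eq hCh fun w hw => hz (hs w hw)]
  have h := hu.weak_space _ ht
  have h2 : ∀ w, inner ℝ (spaceGrad (fun w => φ.normed volume (z - w)) w) v =
      -fderiv ℝ (φ.normed volume) (z - w) (v, 0) := fun w => by
    rw [inner_spaceGrad_eq_fderiv (ht.smooth.differentiable (by simp) w),
      fderiv_comp_const_sub (hρ.differentiable one_ne_zero)]
  rw [← neg_eq_iff_eq_neg] at h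
  -- The vector identity is checked against an arbitrary direction `v`; moving the inner product
  -- inside the integral requires integrability, the last goal.
  rw [← h, inner_neg_left, real_inner_comm, ← integral_inner]
  · simp only [inner_smul_right]
    rw [← integral_neg]
    refine integral_congr_ae (Eventually.of_forall fun w => ?_)
    simp only
    rw [← real_inner_comm v, h2]
    simp [mul_comm]
  · have hcs : tsupport (fun w => φ.normed volume (z - w)) ⊆ C :=
      closure_minimal (fun w hw => hz (hs w hw)) hC.isClosed
    have hcont := continuous_spaceGrad (ht.smooth.of_le (by simp) : ContDiff ℝ 1 _)
    have h0 : ∀ w, w ∉ C → spaceGrad (fun w => φ.normed volume (z - w)) w = 0 := fun w hw =>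
      spaceGrad_eq_zero_of_notMem_tsupport fun h => hw (hcs h)
    have h1 : IntegrableOn (fun w => u w • spaceGrad (fun w => φ.normed volume (z - w)) w) C :=
      (hu.memLr.integrableOn one_le_two hC hCh).smul_continuousOn hcont.continuousOn hC
    exact (h1.integrable_of_forall_notMem_eq_zero fun w hw => by rw [h0 w hw, smul_zero]).integrableOn

end Mollify

theorem tendsto_lintegral_enorm_mollify_sub {F : Type*} [NormedAddCommGroup F] [NormedSpace ℝ F]
    [CompleteSpace F] {ρ : ℕ → ContDiffBump (0 : SpaceTime N)} {K : ℝ}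
    (hρ : Tendsto (fun i => (ρ i).rOut) atTop (𝓝 0))
    (hρ' : ∀ᶠ i in atTop, (ρ i).rOut ≤ K * (ρ i).rIn) {C B : Set (SpaceTime N)} (hBC : B ⊆ C)
    (hBm : MeasurableSet B) (hCm : MeasurableSet C) {f : SpaceTime N → F} (hf : IntegrableOn f C) :
    Tendsto (fun n => ∫⁻ z in B, ‖((ρ n).normed volume ⋆[ContinuousLinearMap.lsmul ℝ ℝ, volume]
      C.indicator f) z - f z‖ₑ) atTop (𝓝 0) := by
  refine tendsto_of_tendsto_of_tendsto_of_le_of_le tendsto_const_nhds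
    (tendsto_lintegral_enorm_convolution_sub hρ hρ' (hf.integrable_indicator hCm))
    (fun _ => zero_le) fun n => ?_
  calc _ = ∫⁻ z in B, ‖((ρ n).normed volume ⋆[ContinuousLinearMap.lsmul ℝ ℝ, volume]
      C.indicator f) z - C.indicator f z‖ₑ :=
        setLIntegral_congr_fun hBm fun z hz => by rw [indicator_of_mem (hBC hz)]
    _ ≤ _ := setLIntegral_le_lintegral _ _

/-- Local approximation of a nonnegative Sobolev function by nonnegative smooth functions. -/
theorem IsSobolevLoc.exists_smooth_approx {u ut : SpaceTime N → ℝ} {Du : SpaceTime N → Space N}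
    (hu : IsSobolevLoc 2 u ut Du) (h0 : ∀ z, 0 ≤ u z) {B : Set (SpaceTime N)} (hB : IsCompact B)
    (hBh : B ⊆ halfSpace N) :
    ∃ v : ℕ → SpaceTime N → ℝ, (∀ n, ContDiff ℝ ∞ (v n)) ∧ (∀ n z, 0 ≤ v n z) ∧
      (∀ᵐ z ∂volume.restrict B, Tendsto (fun n => v n z) atTop (𝓝 (u z))) ∧
      Tendsto (fun n => ∫⁻ z in B, ‖v n z - u z‖ₑ) atTop (𝓝 0) ∧
      Tendsto (fun n => ∫⁻ z in B, ‖timeDeriv (v n) z - ut z‖ₑ) atTop (𝓝 0) ∧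
      Tendsto (fun n => ∫⁻ z in B, ‖spaceGrad (v n) z - Du z‖ₑ) atTop (𝓝 0) := by
  -- A compact thickening of `B` inside the half space leaves room for mollification at all radii up
  -- to `δ`.
  obtain ⟨δ, hδ, hδh⟩ := hB.exists_cthickening_subset_open isOpen_halfSpace hBh
  set C := Metric.cthickening δ B with hCdef
  have hC : IsCompact C := hB.cthickening
  have hBC : B ⊆ C := Metric.self_subset_cthickening B
  -- The fixed ratio of outer to inner radius is what almost everywhere convergence of the
  -- mollifications requires.
  let ρ : ℕ → ContDiffBump (0 : SpaceTime N) := fun n =>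
    { rIn := δ / (n + 1) / 2
      rOut := δ / (n + 1)
      rIn_pos := by positivity
      rIn_lt_rOut := half_lt_self (by positivity) }
  have hρle : ∀ n, (ρ n).rOut ≤ δ := fun n =>
    div_le_self hδ.le (by linarith [(Nat.cast_nonneg n : (0 : ℝ) ≤ n)])
  have hρ : Tendsto (fun i => (ρ i).rOut) atTop (𝓝 0) := by
    have := (tendsto_one_div_add_atTop_nhds_zero_nat (𝕜 := ℝ)).const_mul δ
    simpa [ρ, div_eq_mul_inv] using this
  have hρ' : ∀ᶠ i in atTop, (ρ i).rOut ≤ 2 * (ρ i).rIn :=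
    Eventually.of_forall fun n => by simp only [ρ]; linarith
  have hball : ∀ n, ∀ z ∈ B, Metric.closedBall z (ρ n).rOut ⊆ C := fun n z hz =>
    (Metric.closedBall_subset_closedBall (hρle n)).trans
      (Metric.closedBall_subset_cthickening hz δ)
  have hui := hu.memLr.integrableOn one_le_two hC hδh
  have hint : Integrable (C.indicator u) := hui.integrable_indicator hC.measurableSet
  refine ⟨fun n => (ρ n).normed volume ⋆[ContinuousLinearMap.lsmul ℝ ℝ, volume] C.indicator u,
    fun n => ?_, fun n z => ?_, ?_, ?_, ?_, ?_⟩
  · exact (ρ n).hasCompactSupport_normed.contDiff_convolution_left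
      (ContinuousLinearMap.lsmul ℝ ℝ) (ρ n).contDiff_normed hint.locallyIntegrable
  · simp only [convolution, ContinuousLinearMap.lsmul_apply]
    exact integral_nonneg fun t => smul_nonneg ((ρ n).nonneg_normed t)
      (indicator_nonneg (fun w _ => h0 w) _)
  · rw [ae_restrict_iff' hB.measurableSet]
    filter_upwards [ContDiffBump.ae_convolution_tendsto_right_of_locallyIntegrable hρ hρ'
      hint.locallyIntegrable] with z hz hzB
    rwa [indicator_of_mem (hBC hzB)] at hz
  · exact tendsto_lintegral_enorm_mollify_sub hρ hρ' hBC hB.measurableSet hC.measurableSet hui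
  · refine (tendsto_lintegral_enorm_mollify_sub hρ hρ' hBC hB.measurableSet hC.measurableSet
      (hu.memLr_time.integrableOn one_le_two hC hδh)).congr fun n => ?_
    refine setLIntegral_congr_fun hB.measurableSet fun z hz => ?_
    simp only [timeDeriv_mollify hu hC hδh (hball n z hz)]
  · refine (tendsto_lintegral_enorm_mollify_sub hρ hρ' hBC hB.measurableSet hC.measurableSet
      (hu.memLr_space.integrableOn one_le_two hC hδh)).congr fun n => ?_
    refine setLIntegral_congr_fun hB.measurableSet fun z hz => ?_
    simp only [spaceGrad_mollify hu hC hδh (hball n z hz)]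

/-! ### Nonlinear test functions -/

/-- Products of an `L¹`-convergent sequence with a bounded almost everywhere convergent one. -/
theorem tendsto_integral_mul_of_tendsto_L1 {α : Type*} [MeasurableSpace α] {μ : Measure α}
    {a b : ℕ → α → ℝ} {a' b' : α → ℝ} {M : ℝ} (ha : ∀ n, AEStronglyMeasurable (a n) μ)
    (ha' : Integrable a' μ) (hlim : Tendsto (fun n => ∫⁻ x, ‖a n x - a' x‖ₑ ∂μ) atTop (𝓝 0))
    (hb : ∀ n, AEStronglyMeasurable (b n) μ) (hbM : ∀ n, ∀ᵐ x ∂μ, |b n x| ≤ M)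
    (hblim : ∀ᵐ x ∂μ, Tendsto (fun n => b n x) atTop (𝓝 (b' x))) :
    Tendsto (fun n => ∫ x, b n x * a n x ∂μ) atTop (𝓝 (∫ x, b' x * a' x ∂μ)) := by
  have h1 : Tendsto (fun n => ∫ x, b n x * a' x ∂μ) atTop (𝓝 (∫ x, b' x * a' x ∂μ)) := by
    refine tendsto_integral_of_dominated_convergence (fun x => M * |a' x|)
      (fun n => (hb n).mul ha'.aestronglyMeasurable) (ha'.abs.const_mul M) (fun n => ?_) ?_
    · filter_upwards [hbM n] with x hx
      rw [Real.norm_eq_abs, abs_mul]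
      gcongr
    · filter_upwards [hblim] with x hx using hx.mul_const _
  have hfin : ∀ᶠ n in atTop, ∫⁻ x, ‖a n x - a' x‖ₑ ∂μ < ⊤ :=
    hlim.eventually_lt_const ENNReal.zero_lt_top
  have hdiff : ∀ᶠ n in atTop, Integrable (fun x => a n x - a' x) μ := by
    filter_upwards [hfin] with n hn using ⟨(ha n).sub ha'.aestronglyMeasurable, hn⟩
  have h2 : Tendsto (fun n => ∫ x, b n x * (a n x - a' x) ∂μ) atTop (𝓝 0) := by
    refine squeeze_zero_norm' (a := fun n => |M| * (∫⁻ x, ‖a n x - a' x‖ₑ ∂μ).toReal) ?_ ?_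
    · filter_upwards [hdiff] with n hn
      have : (∫⁻ x, ‖a n x - a' x‖ₑ ∂μ).toReal = ∫ x, ‖a n x - a' x‖ ∂μ :=
        (integral_norm_eq_lintegral_enorm hn.aestronglyMeasurable).symm
      rw [this, ← integral_const_mul]
      refine (norm_integral_le_integral_norm _).trans
        (integral_mono_of_nonneg (Eventually.of_forall fun _ => norm_nonneg _)
          (hn.norm.const_mul _) ?_)
      filter_upwards [hbM n] with x hx
      rw [norm_mul, Real.norm_eq_abs (b n x)]
      have := hx.trans (le_abs_self M)
      gcongr
    · have := ((ENNReal.tendsto_toReal ENNReal.zero_ne_top).comp hlim).const_mul |M|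
      simpa using this
  have h3 := h1.add h2
  rw [add_zero] at h3
  refine h3.congr' ?_
  filter_upwards [hdiff] with n hn
  rw [← integral_add]
  · refine integral_congr_ae (Eventually.of_forall fun x => ?_)
    simp only
    ring
  · exact ha'.bdd_mul (hb n) (hbM n)
  · exact hn.bdd_mul (hb n) (hbM n)

theorem integral_timeDeriv_mul_eq_neg {f ψ : SpaceTime N → ℝ} (hf : ContDiff ℝ 1 f)
    (hψ : ContDiff ℝ 1 ψ) (hc : HasCompactSupport ψ) :
    ∫ z in tsupport ψ, ψ z * timeDeriv f z = -∫ z in tsupport ψ, timeDeriv ψ z * f z := by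
  have hB : ∀ g : SpaceTime N → ℝ, (∀ z ∉ tsupport ψ, g z = 0) →
      ∫ z in tsupport ψ, g z = ∫ z, g z := fun g hg =>
    setIntegral_eq_integral_of_forall_compl_eq_zero hg
  rw [hB _ fun z hz => by rw [image_eq_zero_of_notMem_tsupport hz, zero_mul],
    hB _ fun z hz => by rw [timeDeriv_eq_zero_of_notMem_tsupport hz, zero_mul]]
  have hfd := hf.differentiable one_ne_zero
  have hψd := hψ.differentiable one_ne_zero
  have e1 : ∀ z, timeDeriv f z = fderiv ℝ f z (0, 1) := fun z => timeDeriv_eq_fderiv (hfd z)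
  have e2 : ∀ z, timeDeriv ψ z = fderiv ℝ ψ z (0, 1) := fun z => timeDeriv_eq_fderiv (hψd z)
  simp only [e1, e2]
  have c1 : Continuous fun z => fderiv ℝ f z (0, 1) :=
    (hf.continuous_fderiv one_ne_zero).clm_apply continuous_const
  have c2 : Continuous fun z => fderiv ℝ ψ z (0, 1) :=
    (hψ.continuous_fderiv one_ne_zero).clm_apply continuous_const
  refine integral_mul_fderiv_eq_neg_fderiv_mul_of_integrable ?_ ?_ ?_ (fun z _ => hψd z)
    (fun z _ => hfd z)
  · refine (c2.mul hf.continuous).integrable_of_hasCompactSupport ?_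
    exact ((hc.fderiv ℝ).comp_left (g := fun L : SpaceTime N →L[ℝ] ℝ => L (0, 1)) rfl).mul_right
  · exact (hψ.continuous.mul c1).integrable_of_hasCompactSupport hc.mul_right
  · exact (hψ.continuous.mul hf.continuous).integrable_of_hasCompactSupport hc.mul_right

theorem timeDeriv_comp_mul {h : ℝ → ℝ} {v ψ : SpaceTime N → ℝ} {z : SpaceTime N}
    (hh : DifferentiableAt ℝ h (v z)) (hv : DifferentiableAt ℝ v z)
    (hψ : DifferentiableAt ℝ ψ z) :
    timeDeriv (fun z => h (v z) * ψ z) z =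
      deriv h (v z) * ψ z * timeDeriv v z + h (v z) * timeDeriv ψ z := by
  have h1 : HasDerivAt (fun t => h (v (z.1, t))) (deriv h (v z) * timeDeriv v z) z.2 := by
    rw [timeDeriv_eq_fderiv hv]
    exact HasDerivAt.comp z.2 (h₂ := h) hh.hasDerivAt (hasDerivAt_time hv)
  have h2 : HasDerivAt (fun t => ψ (z.1, t)) (timeDeriv ψ z) z.2 := by
    rw [timeDeriv_eq_fderiv hψ]
    exact hasDerivAt_time hψ
  have h3 := (h1.mul h2).deriv
  simp only [timeDeriv] at h3 ⊢
  refine h3.trans ?_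
  simp only [Prod.mk.eta]
  ring

theorem spaceGrad_comp_mul {h : ℝ → ℝ} {v ψ : SpaceTime N → ℝ} {z : SpaceTime N}
    (hh : DifferentiableAt ℝ h (v z)) (hv : DifferentiableAt ℝ v z)
    (hψ : DifferentiableAt ℝ ψ z) :
    spaceGrad (fun z => h (v z) * ψ z) z =
      (deriv h (v z) * ψ z) • spaceGrad v z + h (v z) • spaceGrad ψ z := by
  have h1 : HasFDerivAt (fun z => h (v z)) (deriv h (v z) • fderiv ℝ v z) z :=
    hh.hasDerivAt.comp_hasFDerivAt z hv.hasFDerivAt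
  have h2 : HasFDerivAt (fun z => h (v z) * ψ z)
      (h (v z) • fderiv ℝ ψ z + ψ z • deriv h (v z) • fderiv ℝ v z) z := h1.mul hψ.hasFDerivAt
  rw [spaceGrad_eq_iff h2.differentiableAt, h2.fderiv]
  intro w
  simp only [add_apply, smul_apply, smul_eq_mul,
    inner_add_left, inner_smul_left, inner_spaceGrad_eq_fderiv hv, inner_spaceGrad_eq_fderiv hψ,
    RCLike.conj_to_real]
  ring

/-- The nonlinear test functions `h(u) ψ` are admissible in a weak differential inequality whose
flux is bounded. -/
theorem lintegral_source_le_of_nonlinear_test {u ut : SpaceTime N → ℝ}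
    {Du G : SpaceTime N → Space N} {F : SpaceTime N → ℝ≥0∞} (hu : IsSobolevLoc 2 u ut Du)
    (h0 : ∀ z, 0 ≤ u z) (hG : AEStronglyMeasurable G (volume.restrict (halfSpace N)))
    (hG1 : ∀ z, ‖G z‖ ≤ 1)
    (hw : ∀ φ, IsInteriorTest φ → (∀ z, 0 ≤ φ z) →
      ∫⁻ z in halfSpace N, F z * ENNReal.ofReal (φ z) ≤
        ENNReal.ofReal ((∫ z in halfSpace N, ut z * φ z) +
          ∫ z in halfSpace N, inner ℝ (G z) (spaceGrad φ z)))
    {h H : ℝ → ℝ} {M : ℝ} (hh : ∀ s, 0 ≤ s → ContDiffAt ℝ ∞ h s)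
    (hHc : ∀ s, 0 ≤ s → ContDiffAt ℝ 1 H s) (hH : ∀ s, 0 ≤ s → HasDerivAt H (h s) s) (h1 : ∀ s, 0 ≤ s → 1 ≤ h s)
    (hM : ∀ s, 0 ≤ s → h s ≤ M) (hM' : ∀ s, 0 ≤ s → |deriv h s| ≤ M)
    {ψ : SpaceTime N → ℝ} (hψ : IsInteriorTest ψ) (hψ0 : ∀ z, 0 ≤ ψ z) :
    ∫⁻ z in halfSpace N, F z * ENNReal.ofReal (ψ z) ≤
      ENNReal.ofReal (∫ z in tsupport ψ, (-(timeDeriv ψ z * H (u z)) +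
        (deriv h (u z) * ψ z * inner ℝ (G z) (Du z) +
          h (u z) * inner ℝ (G z) (spaceGrad ψ z)))) := by
  set B := tsupport ψ with hBdef
  have hB : IsCompact B := hψ.compact
  have hBh : B ⊆ halfSpace N := hψ.support_subset
  have hBm : MeasurableSet B := hB.measurableSet
  set μ := (volume : Measure (SpaceTime N)).restrict B with hμ
  have hGB : AEStronglyMeasurable G μ := hG.mono_measure (Measure.restrict_mono hBh le_rfl)
  -- The approximants are nonnegative, so `h` and `H` are evaluated only where they are assumed
  -- regular.
  obtain ⟨v, hv, hv0, hvae, hv1, hvt, hvx⟩ := hu.exists_smooth_approx h0 hB hBh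
  have hψ1 : ContDiff ℝ 1 ψ := hψ.smooth.of_le (by simp)
  have hv1' : ∀ n, ContDiff ℝ 1 (v n) := fun n => (hv n).of_le (by simp)
  have hut : Integrable ut μ := hu.memLr_time.integrableOn one_le_two hB hBh
  have huB : Integrable u μ := hu.memLr.integrableOn one_le_two hB hBh
  have hDu : Integrable Du μ := hu.memLr_space.integrableOn one_le_two hB hBh
  obtain ⟨P, hP⟩ : ∃ P, ∀ z, ‖ψ z‖ ≤ P := hψ.compact.exists_bound_of_continuous hψ1.continuous
  have hP0 : 0 ≤ P := (norm_nonneg _).trans (hP 0)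
  have hM0 : 0 ≤ M := zero_le_one.trans ((h1 0 le_rfl).trans (hM 0 le_rfl))
  have hhv : ∀ n, ContDiff ℝ ∞ (fun z => h (v n z)) := fun n =>
    contDiff_iff_contDiffAt.2 fun z => (hh _ (hv0 n z)).comp z (hv n).contDiffAt
  have hdc : ∀ s, 0 ≤ s → ContinuousAt (deriv h) s := fun s hs =>
    ((hh s hs).continuousAt_fderiv (by simp)).clm_apply continuousAt_const
  have hdv : ∀ n, Continuous fun z => deriv h (v n z) := fun n =>
    continuous_iff_continuousAt.2 fun z =>
      ContinuousAt.comp (g := deriv h) (hdc _ (hv0 n z)) (hv n).continuous.continuousAt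
  have hHv : ∀ n, ContDiff ℝ 1 (fun z => H (v n z)) := fun n =>
    contDiff_iff_contDiffAt.2 fun z => (hHc _ (hv0 n z)).comp z (hv1' n).contDiffAt
  have hlip : ∀ x y, 0 ≤ x → 0 ≤ y → |H y - H x| ≤ M * |y - x| := fun x y hx hy =>
    Convex.norm_image_sub_le_of_norm_hasDerivWithin_le (s := Ici (0 : ℝ)) (f' := h)
      (fun s hs => (hH s hs).hasDerivWithinAt)
      (fun s hs => by
        rw [Real.norm_eq_abs, abs_of_nonneg (zero_le_one.trans (h1 s hs))]
        exact hM s hs) (convex_Ici 0) hx hy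
  have bh : ∀ n z, |h (v n z)| ≤ M := fun n z => by
    rw [abs_of_nonneg (zero_le_one.trans (h1 _ (hv0 n z)))]
    exact hM _ (hv0 n z)
  have bhψ : ∀ n z, |h (v n z) * ψ z| ≤ M * P := fun n z => by
    rw [abs_mul]
    exact mul_le_mul (bh n z) (hP z) (abs_nonneg _) hM0
  have bdψ : ∀ n z, |deriv h (v n z) * ψ z| ≤ M * P := fun n z => by
    rw [abs_mul]
    exact mul_le_mul (hM' _ (hv0 n z)) (hP z) (abs_nonneg _) hM0
  have chψ : ∀ n, Continuous fun z => h (v n z) * ψ z := fun n =>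
    (hhv n).continuous.mul hψ1.continuous
  have cdψ : ∀ n, Continuous fun z => deriv h (v n z) * ψ z := fun n =>
    (hdv n).mul hψ1.continuous
  have lh : ∀ᵐ z ∂μ, Tendsto (fun n => h (v n z)) atTop (𝓝 (h (u z))) := by
    filter_upwards [hvae] with z hz using (hh _ (h0 z)).continuousAt.tendsto.comp hz
  have lhψ : ∀ᵐ z ∂μ, Tendsto (fun n => h (v n z) * ψ z) atTop (𝓝 (h (u z) * ψ z)) := by
    filter_upwards [lh] with z hz using hz.mul_const _
  have ldψ : ∀ᵐ z ∂μ, Tendsto (fun n => deriv h (v n z) * ψ z) atTop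
      (𝓝 (deriv h (u z) * ψ z)) := by
    filter_upwards [hvae] with z hz using ((hdc _ (h0 z)).tendsto.comp hz).mul_const _
  have hinner : ∀ {f : SpaceTime N → Space N}, Integrable f μ →
      Integrable (fun z => inner ℝ (G z) (f z)) μ := fun {f} hf => by
    refine hf.norm.mono (hGB.inner hf.aestronglyMeasurable) (Eventually.of_forall fun z => ?_)
    rw [norm_norm]
    refine (norm_inner_le_norm _ _).trans ?_
    exact mul_le_of_le_one_left (norm_nonneg _) (hG1 z)
  have hcint : ∀ {f : SpaceTime N → Space N}, Continuous f → Integrable f μ := fun hf =>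
    hf.continuousOn.integrableOn_compact hB
  have igv : ∀ n, Integrable (fun z => inner ℝ (G z) (spaceGrad (v n) z)) μ := fun n =>
    hinner (hcint (continuous_spaceGrad (hv1' n)))
  have igψ : Integrable (fun z => inner ℝ (G z) (spaceGrad ψ z)) μ :=
    hinner (hcint (continuous_spaceGrad hψ1))
  have igD : Integrable (fun z => inner ℝ (G z) (Du z)) μ := hinner hDu
  -- passage to the limit in the individual terms
  have L1 : Tendsto (fun n => ∫ z, h (v n z) * ψ z * ut z ∂μ) atTop
      (𝓝 (∫ z, h (u z) * ψ z * ut z ∂μ)) :=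
    tendsto_integral_mul_of_tendsto_L1 (a := fun _ => ut) (fun _ => hut.aestronglyMeasurable) hut
      (by simp) (fun n => (chψ n).aestronglyMeasurable)
      (fun n => Eventually.of_forall (bhψ n)) lhψ
  -- Since `‖G‖ ≤ 1`, convergence of the gradients in `L¹` suffices.
  have L2 : Tendsto (fun n => ∫ z, deriv h (v n z) * ψ z * inner ℝ (G z) (spaceGrad (v n) z) ∂μ)
      atTop (𝓝 (∫ z, deriv h (u z) * ψ z * inner ℝ (G z) (Du z) ∂μ)) := by
    refine tendsto_integral_mul_of_tendsto_L1 (fun n => (igv n).aestronglyMeasurable) igD ?_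
      (fun n => (cdψ n).aestronglyMeasurable) (fun n => Eventually.of_forall (bdψ n)) ldψ
    refine tendsto_of_tendsto_of_tendsto_of_le_of_le tendsto_const_nhds hvx (fun _ => zero_le)
      fun n => lintegral_mono fun z => ?_
    simp only
    rw [← inner_sub_right, ← ofReal_norm, ← ofReal_norm]
    refine ENNReal.ofReal_le_ofReal ((norm_inner_le_norm _ _).trans ?_)
    exact mul_le_of_le_one_left (norm_nonneg _) (hG1 z)
  have L3 : Tendsto (fun n => ∫ z, h (v n z) * inner ℝ (G z) (spaceGrad ψ z) ∂μ) atTop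
      (𝓝 (∫ z, h (u z) * inner ℝ (G z) (spaceGrad ψ z) ∂μ)) :=
    tendsto_integral_mul_of_tendsto_L1 (a := fun _ z => inner ℝ (G z) (spaceGrad ψ z))
      (fun _ => igψ.aestronglyMeasurable) igψ (by simp)
      (fun n => (hhv n).continuous.aestronglyMeasurable) (fun n => Eventually.of_forall (bh n)) lh
  have L4 : Tendsto (fun n => ∫ z, h (v n z) * ψ z * timeDeriv (v n) z ∂μ) atTop
      (𝓝 (∫ z, h (u z) * ψ z * ut z ∂μ)) :=
    tendsto_integral_mul_of_tendsto_L1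
      (fun n => (continuous_timeDeriv (hv1' n)).aestronglyMeasurable) hut hvt
      (fun n => (chψ n).aestronglyMeasurable) (fun n => Eventually.of_forall (bhψ n)) lhψ
  have lH : ∀ᵐ z ∂μ, Tendsto (fun n => H (v n z)) atTop (𝓝 (H (u z))) := by
    filter_upwards [hvae] with z hz using (hHc _ (h0 z)).continuousAt.tendsto.comp hz
  -- `H` is Lipschitz on the half line because `h` is bounded, hence `H(u)` grows at most linearly
  -- in `u`.
  have iH : Integrable (fun z => H (u z)) μ := by
    have hm : AEStronglyMeasurable (fun z => H (u z)) μ :=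
      aestronglyMeasurable_of_tendsto_ae atTop
        (fun n => (hHv n).continuous.aestronglyMeasurable) lH
    have : IsFiniteMeasure μ := isFiniteMeasure_restrict.2 hB.measure_lt_top.ne
    refine ((huB.norm.const_mul M).add (integrable_const |H 0|)).mono hm
      (Eventually.of_forall fun z => ?_)
    have h2 := hlip 0 (u z) le_rfl (h0 z)
    rw [sub_zero] at h2
    simp only [Pi.add_apply, Real.norm_eq_abs]
    refine le_trans ?_ (le_abs_self _)
    have h3 := abs_sub_abs_le_abs_sub (H (u z)) (H 0)
    linarith
  obtain ⟨Q, hQ⟩ : ∃ Q, ∀ z ∈ B, ‖timeDeriv ψ z‖ ≤ Q :=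
    hB.exists_bound_of_continuousOn (continuous_timeDeriv hψ1).continuousOn
  have hQ' : ∀ᵐ z ∂μ, |timeDeriv ψ z| ≤ Q :=
    (ae_restrict_iff' hBm).2 (Eventually.of_forall hQ)
  have L5 : Tendsto (fun n => ∫ z, timeDeriv ψ z * H (v n z) ∂μ) atTop
      (𝓝 (∫ z, timeDeriv ψ z * H (u z) ∂μ)) := by
    refine tendsto_integral_mul_of_tendsto_L1 (b := fun _ => timeDeriv ψ)
      (fun n => (hHv n).continuous.aestronglyMeasurable) iH ?_
      (fun n => (continuous_timeDeriv hψ1).aestronglyMeasurable) (fun _ => hQ')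
      (Eventually.of_forall fun z => tendsto_const_nhds)
    have := ENNReal.Tendsto.const_mul (a := ENNReal.ofReal M) hv1 (Or.inr ENNReal.ofReal_ne_top)
    rw [mul_zero] at this
    refine tendsto_of_tendsto_of_tendsto_of_le_of_le tendsto_const_nhds this
      (fun _ => zero_le) fun n => ?_
    simp only
    rw [← lintegral_const_mul' _ _ ENNReal.ofReal_ne_top]
    refine lintegral_mono fun z => ?_
    simp only
    rw [← ofReal_norm, ← ofReal_norm, ← ENNReal.ofReal_mul hM0]
    exact ENNReal.ofReal_le_ofReal (hlip _ _ (h0 z) (hv0 n z))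
  -- The weak chain rule `h(u) u_t = (H(u))_t`: for `v n` it is classical integration by parts, and
  -- both sides pass to the limit.
  have L45 : ∫ z, h (u z) * ψ z * ut z ∂μ = -∫ z, timeDeriv ψ z * H (u z) ∂μ := by
    refine tendsto_nhds_unique L4 (L5.neg.congr fun n => ?_)
    rw [← integral_timeDeriv_mul_eq_neg (hHv n) hψ1 hψ.compact]
    refine integral_congr_ae (Eventually.of_forall fun z => ?_)
    -- With second factor `1`, the product rule is the plain chain rule for `H(v n)`.
    have hc := timeDeriv_comp_mul (h := H) (ψ := fun _ => 1) (z := z)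
      (hH _ (hv0 n z)).differentiableAt ((hv1' n).differentiable one_ne_zero z)
      (differentiableAt_const _)
    simp only [mul_one, (hH _ (hv0 n z)).deriv, timeDeriv, deriv_const, mul_zero, add_zero] at hc
    simp only [timeDeriv, hc]
    ring
  -- The smooth function `h(v n) ψ` is an admissible test function, and `h ≥ 1` allows `ψ` alone to
  -- be kept on the left.
  have hstep : ∀ n, ∫⁻ z in halfSpace N, F z * ENNReal.ofReal (ψ z) ≤
      ENNReal.ofReal ((∫ z, h (v n z) * ψ z * ut z ∂μ) +
        ((∫ z, deriv h (v n z) * ψ z * inner ℝ (G z) (spaceGrad (v n) z) ∂μ) +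
          ∫ z, h (v n z) * inner ℝ (G z) (spaceGrad ψ z) ∂μ)) := fun n => by
    have hts : tsupport (fun z => h (v n z) * ψ z) ⊆ B := tsupport_mul_subset_right
    have hφ : IsInteriorTest fun z => h (v n z) * ψ z :=
      ⟨(hhv n).mul hψ.smooth, hψ.compact.mul_left, hts.trans hBh⟩
    have hres : ∀ g : SpaceTime N → ℝ, (∀ z ∉ B, g z = 0) →
        ∫ z in halfSpace N, g z = ∫ z, g z ∂μ := fun g hg =>
      (setIntegral_eq_of_subset_of_forall_sdiff_eq_zero measurableSet_halfSpace hBh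
        fun z hz => hg z hz.2)
    refine le_trans (lintegral_mono fun z => ?_) ((hw _ hφ fun z =>
      mul_nonneg (zero_le_one.trans (h1 _ (hv0 n z))) (hψ0 z)).trans_eq ?_)
    · gcongr
      exact le_mul_of_one_le_left (hψ0 z) (h1 _ (hv0 n z))
    · rw [hres _ fun z hz => by
          rw [image_eq_zero_of_notMem_tsupport hz, mul_zero, mul_zero],
        hres _ fun z hz => by
          rw [spaceGrad_eq_zero_of_notMem_tsupport fun h => hz (hts h), inner_zero_right],
        ← integral_add ((igv n).bdd_mul (cdψ n).aestronglyMeasurable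
          (Eventually.of_forall (bdψ n))) (igψ.bdd_mul (hhv n).continuous.aestronglyMeasurable
          (Eventually.of_forall (bh n)))]
      congr 2
      · exact integral_congr_ae (Eventually.of_forall fun z => by simp only; ring)
      · refine integral_congr_ae (Eventually.of_forall fun z => ?_)
        simp only
        rw [spaceGrad_comp_mul ((hh _ (hv0 n z)).differentiableAt (by simp))
          ((hv1' n).differentiable one_ne_zero z) (hψ1.differentiable one_ne_zero z),
          inner_add_right, inner_smul_right, inner_smul_right]
  have hlim := ge_of_tendsto' (ENNReal.tendsto_ofReal (L1.add (L2.add L3))) hstep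
  have iT : Integrable (fun z => timeDeriv ψ z * H (u z)) μ :=
    iH.bdd_mul (continuous_timeDeriv hψ1).aestronglyMeasurable hQ'
  have bd_lim : ∀ {b : ℕ → SpaceTime N → ℝ} {b' : SpaceTime N → ℝ} {c : ℝ},
      (∀ n z, |b n z| ≤ c) → (∀ᵐ z ∂μ, Tendsto (fun n => b n z) atTop (𝓝 (b' z))) →
      ∀ᵐ z ∂μ, ‖b' z‖ ≤ c := fun {b b' c} hb hl => by
    filter_upwards [hl] with z hz
    exact le_of_tendsto hz.abs (Eventually.of_forall fun n => hb n z)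
  have iD : Integrable (fun z => deriv h (u z) * ψ z * inner ℝ (G z) (Du z)) μ :=
    igD.bdd_mul (aestronglyMeasurable_of_tendsto_ae atTop
      (fun n => (cdψ n).aestronglyMeasurable) ldψ) (bd_lim bdψ ldψ)
  have iψ : Integrable (fun z => h (u z) * inner ℝ (G z) (spaceGrad ψ z)) μ :=
    igψ.bdd_mul (aestronglyMeasurable_of_tendsto_ae atTop
      (fun n => (hhv n).continuous.aestronglyMeasurable) lh) (bd_lim bh lh)
  rw [L45] at hlim
  refine hlim.trans_eq (congrArg ENNReal.ofReal ?_)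
  rw [← integral_neg, ← integral_add iD iψ]
  exact (integral_add iT.neg (iD.add iψ)).symm

/-! ### Lower bounds for the kernel and the source -/

/-- Near `0` the lower limit bounds `K` below, on a compact annulus continuity and positivity do,
and there `R^(-β) ≤ 1` is enough; farther out the decay assumption applies. The factor `4` is the
diameter of the ball of radius `2R` that contains the spatial support of the cut-off. -/
theorem IsAdmissibleKernel.exists_pos_mul_rpow_le {β : ℝ} {K : Space N → ℝ}
    (hK : IsAdmissibleKernel β K) (hβ : 0 < β) :
    ∃ c > 0, ∀ R, 1 ≤ R → ∀ x, x ≠ 0 → ‖x‖ ≤ 4 * R → c * R ^ (-β) ≤ K x := by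
  obtain ⟨e, he0, he⟩ := EReal.lt_iff_exists_real_btwn.1 hK.liminf_pos
  have hev := eventually_lt_of_lt_liminf he
  rw [eventually_nhdsWithin_iff, Metric.eventually_nhds_iff] at hev
  obtain ⟨δ, hδ, hev⟩ := hev
  obtain ⟨ρ, hρ, c, hc, hb⟩ := hK.lower_bound
  have hcpt : IsCompact (Metric.closedBall (0 : Space N) ρ \ Metric.ball 0 δ) :=
    (isCompact_closedBall (0 : Space N) ρ).diff Metric.isOpen_ball
  have hne : ∀ x ∈ Metric.closedBall (0 : Space N) ρ \ Metric.ball 0 δ, x ≠ 0 := by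
    rintro x hx rfl
    exact hx.2 (Metric.mem_ball_self hδ)
  obtain ⟨d, hd, hdK⟩ := hcpt.exists_forall_le' (hK.continuousOn.mono hne)
    (fun x hx => hK.pos x (hne x hx))
  have he0' : 0 < e := by exact_mod_cast he0
  have h4 : (0 : ℝ) < 4 ^ (-β) := by positivity
  refine ⟨min (min e d) (c * 4 ^ (-β)), lt_min (lt_min he0' hd) (by positivity),
    fun R hR x hx hxR => ?_⟩
  have hR0 : 0 < R := by linarith
  have hRβ : R ^ (-β) ≤ 1 := Real.rpow_le_one_of_one_le_of_nonpos hR (by linarith)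
  have hRp : 0 < R ^ (-β) := Real.rpow_pos_of_pos hR0 _
  rcases lt_or_ge ρ ‖x‖ with h | h
  · calc _ ≤ c * 4 ^ (-β) * R ^ (-β) := by gcongr; exact min_le_right _ _
      _ = c * (4 * R) ^ (-β) := by rw [Real.mul_rpow (by norm_num) hR0.le, mul_assoc]
      _ ≤ c * ‖x‖ ^ (-β) := by
        have := Real.rpow_le_rpow_of_nonpos (norm_pos_iff.2 hx) hxR (by linarith : -β ≤ 0)
        gcongr
      _ ≤ K x := hb x h
  · have hm : min (min e d) (c * 4 ^ (-β)) ≤ min e d := min_le_left _ _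
    have h1 : min (min e d) (c * 4 ^ (-β)) * R ^ (-β) ≤ min e d :=
      (mul_le_mul hm hRβ hRp.le (lt_min he0' hd).le).trans (mul_one _).le
    refine h1.trans ?_
    by_cases hxδ : ‖x‖ < δ
    · have : (e : EReal) < (K x : EReal) := hev (by simpa using hxδ) hx
      exact (min_le_left _ _).trans (EReal.coe_lt_coe_iff.1 this).le
    · exact (min_le_right _ _).trans (hdK x ⟨by simpa using h, by simpa using hxδ⟩)

/-- Lower bound of the source: by the Cauchy–Schwarz inequality it controls the square of the
spatial integrals of `u ^ ((p + q) / 2)`. -/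
theorem lintegral_sq_le_lintegral_source [NullSingletonClass (volume : Measure (Space N))]
    {K : Space N → ℝ} {p q d r : ℝ} (hd : 0 ≤ d)
    (hK : ∀ x, x ≠ 0 → ‖x‖ ≤ 2 * r → d ≤ K x) {u φ : SpaceTime N → ℝ} (hu : Measurable u)
    (h0 : ∀ z, 0 ≤ u z) (hφ : Measurable φ) (hφ0 : ∀ z, 0 ≤ φ z) (hφ1 : ∀ z, φ z ≤ 1)
    (hφs : ∀ z, φ z ≠ 0 → z ∈ halfSpace N ∧ ‖z.1‖ ≤ r) (hp : 0 < p) (hq : 0 < q) :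
    ENNReal.ofReal d * ∫⁻ t, (∫⁻ x, ENNReal.ofReal (u (x, t) ^ ((p + q) / 2) * φ (x, t))) ^ 2 ≤
      ∫⁻ z in halfSpace N, source K p q u z * ENNReal.ofReal (φ z) := by
  have hm : ∀ r : ℝ, Measurable fun z => ENNReal.ofReal (u z ^ r * φ z) := fun r =>
    ((hu.pow_const r).mul hφ).ennreal_ofReal
  set P : ℝ → ℝ → ℝ≥0∞ := fun r t => ∫⁻ x, ENNReal.ofReal (u (x, t) ^ r * φ (x, t)) with hP
  have hPm : ∀ r, Measurable (P r) := fun r => (hm r).lintegral_prod_left'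
  have hcs : ∀ t, P ((p + q) / 2) t ^ 2 ≤ P p t * P q t := fun t => by
    have hmt : ∀ r : ℝ, Measurable fun x : Space N => ENNReal.ofReal (u (x, t) ^ r * φ (x, t)) :=
      fun r => (hm r).comp measurable_prodMk_right
    have hol := ENNReal.lintegral_mul_le_Lp_mul_Lq (volume : Measure (Space N))
      (Real.HolderConjugate.two_two)
      ((hmt p).pow_const (1 / 2 : ℝ)).aemeasurable ((hmt q).pow_const (1 / 2 : ℝ)).aemeasurable
    have e1 : ∀ x : Space N, ((fun x => ENNReal.ofReal (u (x, t) ^ p * φ (x, t)) ^ (1 / 2 : ℝ)) *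
        fun x => ENNReal.ofReal (u (x, t) ^ q * φ (x, t)) ^ (1 / 2 : ℝ)) x =
        ENNReal.ofReal (u (x, t) ^ ((p + q) / 2) * φ (x, t)) := fun x => by
      have hx := h0 (x, t)
      have hx' := hφ0 (x, t)
      have hpp := Real.rpow_nonneg hx p
      have hqq := Real.rpow_nonneg hx q
      simp only [Pi.mul_apply]
      rw [ENNReal.ofReal_rpow_of_nonneg (by positivity) (by norm_num),
        ENNReal.ofReal_rpow_of_nonneg (by positivity) (by norm_num),
        ← ENNReal.ofReal_mul (by positivity), ← Real.mul_rpow (by positivity) (by positivity)]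
      congr 1
      rw [show u (x, t) ^ p * φ (x, t) * (u (x, t) ^ q * φ (x, t)) =
        (u (x, t) ^ (p + q)) * (φ (x, t) ^ (2 : ℝ)) by
          rw [Real.rpow_add_of_nonneg hx hp.le hq.le, Real.rpow_two]; ring,
        Real.mul_rpow (by positivity) (by positivity), ← Real.rpow_mul hx, ← Real.rpow_mul hx']
      norm_num
      left
      congr 1
      ring
    have e2 : ∀ a : ℝ≥0∞, (a ^ (1 / 2 : ℝ)) ^ (2 : ℝ) = a := fun a => by
      rw [← ENNReal.rpow_mul]; norm_num
    simp only [e1, e2] at hol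
    calc P ((p + q) / 2) t ^ 2 ≤ (P p t ^ (1 / 2 : ℝ) * P q t ^ (1 / 2 : ℝ)) ^ 2 := by
          gcongr
      _ = P p t * P q t := by
        rw [mul_pow, ← ENNReal.rpow_two, ← ENNReal.rpow_two, e2, e2]
  -- Inserting `φ ≤ 1` in the convolution restricts it to points within `2r` of each other, where `K
  -- ≥ d`; the point `y = z.1`, where `K` is not controlled, is null.
  have hconv : ∀ z, φ z ≠ 0 → ENNReal.ofReal d * P p z.2 ≤ convPow K p u z := fun z hz => by
    rw [hP, convPow, ← lintegral_const_mul' _ _ ENNReal.ofReal_ne_top]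
    refine lintegral_mono_ae ?_
    have hne : ∀ᵐ y : Space N, y ≠ z.1 := by
      rw [ae_iff]
      simp
    filter_upwards [hne] with y hy
    rw [← ENNReal.ofReal_mul hd]
    by_cases hφy : φ (y, z.2) = 0
    · simp [hφy]
    · refine ENNReal.ofReal_le_ofReal ?_
      have h1 : ‖z.1 - y‖ ≤ 2 * r := by
        have := norm_sub_le z.1 y
        linarith [(hφs z hz).2, (hφs _ hφy).2]
      have h2 := hK _ (sub_ne_zero.2 hy.symm) h1
      have h3 := Real.rpow_nonneg (h0 (y, z.2)) p
      calc d * (u (y, z.2) ^ p * φ (y, z.2)) ≤ d * (u (y, z.2) ^ p * 1) := by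
            gcongr
            exact hφ1 _
        _ ≤ _ := by rw [mul_one]; gcongr
  calc ENNReal.ofReal d * ∫⁻ t, P ((p + q) / 2) t ^ 2
      ≤ ENNReal.ofReal d * ∫⁻ t, P p t * P q t := by
        gcongr
        exact hcs _
    _ = ∫⁻ t, ∫⁻ x, ENNReal.ofReal d * P p t * ENNReal.ofReal (u (x, t) ^ q * φ (x, t)) := by
      rw [← lintegral_const_mul' _ _ ENNReal.ofReal_ne_top]
      refine lintegral_congr fun t => ?_
      rw [lintegral_const_mul _ (f := fun x : Space N => ENNReal.ofReal (u (x, t) ^ q * φ (x, t)))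
        ((hm q).comp measurable_prodMk_right), mul_assoc]
    _ = ∫⁻ z : SpaceTime N, ENNReal.ofReal d * P p z.2 * ENNReal.ofReal (u z ^ q * φ z) := by
      rw [Measure.volume_eq_prod, lintegral_prod_symm]
      exact (((hPm p).comp measurable_snd).const_mul _ |>.mul (hm q)).aemeasurable
    _ = ∫⁻ z in halfSpace N, ENNReal.ofReal d * P p z.2 * ENNReal.ofReal (u z ^ q * φ z) := by
      rw [← lintegral_indicator measurableSet_halfSpace]
      refine lintegral_congr fun z => ?_
      by_cases hz : z ∈ halfSpace N
      · rw [indicator_of_mem hz]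
      · rw [indicator_of_notMem hz, not_not.1 fun h => hz (hφs z h).1]
        simp
    _ ≤ _ := by
      refine lintegral_mono fun z => ?_
      simp only
      by_cases hz : φ z = 0
      · simp [hz]
      · rw [source, mul_assoc (convPow K p u z), ← ENNReal.ofReal_mul (Real.rpow_nonneg (h0 z) _)]
        gcongr
        exact hconv z hz

/-! ### The parabolic cut-off -/

theorem smoothTransition_deriv_nonneg (x : ℝ) : 0 ≤ deriv Real.smoothTransition x :=
  Real.smoothTransition.monotone.deriv_nonneg

theorem smoothTransition_deriv_of_neg {x : ℝ} (hx : x < 0) :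
    deriv Real.smoothTransition x = 0 := by
  have : Real.smoothTransition =ᶠ[𝓝 x] fun _ => 0 := by
    filter_upwards [Iio_mem_nhds hx] with y hy using
      Real.smoothTransition.zero_of_nonpos (le_of_lt hy)
  rw [this.deriv_eq, deriv_const]

theorem smoothTransition_deriv_of_one_lt {x : ℝ} (hx : 1 < x) :
    deriv Real.smoothTransition x = 0 := by
  have : Real.smoothTransition =ᶠ[𝓝 x] fun _ => 1 := by
    filter_upwards [Ioi_mem_nhds hx] with y hy using
      Real.smoothTransition.one_of_one_le (le_of_lt hy)
  rw [this.deriv_eq, deriv_const]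

theorem smoothTransition_hasDerivAt (x : ℝ) :
    HasDerivAt Real.smoothTransition (deriv Real.smoothTransition x) x :=
  ((Real.smoothTransition.contDiff (n := 1)).differentiable one_ne_zero x).hasDerivAt

theorem exists_smoothTransition_deriv_le : ∃ M > 0, ∀ x, deriv Real.smoothTransition x ≤ M := by
  have hc : Continuous (deriv Real.smoothTransition) :=
    (Real.smoothTransition.contDiff (n := 1)).continuous_deriv le_rfl
  obtain ⟨M, hM⟩ := isCompact_Icc.exists_bound_of_continuousOn (s := Icc (0 : ℝ) 1)
    hc.continuousOn
  refine ⟨max M 1, by positivity, fun x => ?_⟩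
  rcases lt_or_ge x 0 with h | h
  · rw [smoothTransition_deriv_of_neg h]
    positivity
  rcases lt_or_ge 1 x with h' | h'
  · rw [smoothTransition_deriv_of_one_lt h']
    positivity
  · exact ((le_abs_self _).trans (hM x ⟨h, h'⟩)).trans (le_max_left _ _)

/-- A parabolic cut-off function, equal to `1` where `‖x‖² + t ≤ R²` and `t ≥ 2a`, and vanishing
where `‖x‖² + t ≥ 2R²` or `t ≤ a`. -/
noncomputable def cutoff (a R : ℝ) (z : SpaceTime N) : ℝ :=
  Real.smoothTransition (2 - (‖z.1‖ ^ 2 + z.2) / R ^ 2) *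
    Real.smoothTransition ((z.2 - a) / a)

/-- The region in which the parabolic cut-off function varies away from the initial time. -/
def shell (N : ℕ) (R : ℝ) : Set (SpaceTime N) :=
  {z | R ^ 2 ≤ ‖z.1‖ ^ 2 + z.2 ∧ ‖z.1‖ ^ 2 + z.2 ≤ 2 * R ^ 2}

theorem measurableSet_shell (R : ℝ) : MeasurableSet (shell N R) := by
  have h1 : IsClosed {z : SpaceTime N | R ^ 2 ≤ ‖z.1‖ ^ 2 + z.2} :=
    isClosed_le (by fun_prop) (by fun_prop)
  have h2 : IsClosed {z : SpaceTime N | ‖z.1‖ ^ 2 + z.2 ≤ 2 * R ^ 2} :=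
    isClosed_le (by fun_prop) (by fun_prop)
  exact (h1.inter h2).measurableSet

theorem cutoff_nonneg (a R : ℝ) (z : SpaceTime N) : 0 ≤ cutoff a R z :=
  mul_nonneg (Real.smoothTransition.nonneg _) (Real.smoothTransition.nonneg _)

theorem cutoff_le_one (a R : ℝ) (z : SpaceTime N) : cutoff a R z ≤ 1 :=
  mul_le_one₀ (Real.smoothTransition.le_one _) (Real.smoothTransition.nonneg _)
    (Real.smoothTransition.le_one _)

theorem contDiff_cutoff (a R : ℝ) : ContDiff ℝ ∞ (cutoff (N := N) a R) := by
  refine ContDiff.mul ?_ ?_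
  · exact Real.smoothTransition.contDiff.comp
      (contDiff_const.sub (((contDiff_fst.norm_sq ℝ).add contDiff_snd).div_const _))
  · exact Real.smoothTransition.contDiff.comp ((contDiff_snd.sub contDiff_const).div_const _)

theorem mem_of_cutoff_ne_zero {a R : ℝ} (ha : 0 < a) (hR : 0 < R) {z : SpaceTime N}
    (hz : cutoff a R z ≠ 0) : a ≤ z.2 ∧ ‖z.1‖ ^ 2 + z.2 ≤ 2 * R ^ 2 := by
  constructor
  · by_contra! h
    refine hz ?_
    rw [cutoff, Real.smoothTransition.zero_of_nonpos (x := (z.2 - a) / a), mul_zero]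
    exact div_nonpos_of_nonpos_of_nonneg (by linarith) ha.le
  · by_contra! h
    refine hz ?_
    rw [cutoff, Real.smoothTransition.zero_of_nonpos, zero_mul]
    rw [sub_nonpos, le_div_iff₀ (by positivity)]
    exact h.le

theorem tsupport_cutoff_subset {a R : ℝ} (ha : 0 < a) (hR : 0 < R) :
    tsupport (cutoff (N := N) a R) ⊆ {z | a ≤ z.2 ∧ ‖z.1‖ ^ 2 + z.2 ≤ 2 * R ^ 2} := by
  have h1 : IsClosed {z : SpaceTime N | a ≤ z.2} := isClosed_le (by fun_prop) (by fun_prop)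
  have h2 : IsClosed {z : SpaceTime N | ‖z.1‖ ^ 2 + z.2 ≤ 2 * R ^ 2} :=
    isClosed_le (by fun_prop) (by fun_prop)
  exact closure_minimal (fun _ hz => mem_of_cutoff_ne_zero ha hR hz) (h1.inter h2)

theorem subset_closedBall_prod_Icc {a R : ℝ} (ha : 0 < a) (hR : 0 < R) :
    {z : SpaceTime N | a ≤ z.2 ∧ ‖z.1‖ ^ 2 + z.2 ≤ 2 * R ^ 2} ⊆
      Metric.closedBall (0 : Space N) (2 * R) ×ˢ Icc 0 (2 * R ^ 2) := by
  rintro z ⟨h1, h2⟩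
  refine ⟨?_, by linarith, by nlinarith [sq_nonneg ‖z.1‖]⟩
  rw [mem_closedBall_zero_iff]
  refine abs_le_of_sq_le_sq' (by nlinarith) (by positivity) |>.2

theorem isInteriorTest_cutoff_pow {a R : ℝ} (ha : 0 < a) (hR : 0 < R) {k : ℕ} (hk : k ≠ 0) :
    IsInteriorTest (fun z : SpaceTime N => cutoff a R z ^ k) ∧
      tsupport (fun z : SpaceTime N => cutoff a R z ^ k) ⊆
        Metric.closedBall (0 : Space N) (2 * R) ×ˢ Icc 0 (2 * R ^ 2) := by
  have hsub : tsupport (fun z : SpaceTime N => cutoff a R z ^ k) ⊆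
      {z | a ≤ z.2 ∧ ‖z.1‖ ^ 2 + z.2 ≤ 2 * R ^ 2} := by
    refine (closure_mono fun z hz => ?_).trans (tsupport_cutoff_subset ha hR)
    exact fun h => hz (by simp [h, hk])
  have hsub' := hsub.trans (subset_closedBall_prod_Icc ha hR)
  refine ⟨⟨(contDiff_cutoff a R).pow k, ?_, ?_⟩, hsub'⟩
  · exact ((isCompact_closedBall _ _).prod isCompact_Icc).of_isClosed_subset
      (isClosed_tsupport _) hsub'
  · exact fun z hz => ⟨mem_univ _, ha.trans_le (hsub hz).1⟩

theorem deriv_smoothTransition_shell {R : ℝ} (hR : 0 < R) {z : SpaceTime N} (hz : z ∉ shell N R) :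
    deriv Real.smoothTransition (2 - (‖z.1‖ ^ 2 + z.2) / R ^ 2) = 0 := by
  have hR2 : 0 < R ^ 2 := by positivity
  rcases lt_or_ge (‖z.1‖ ^ 2 + z.2) (R ^ 2) with h | h
  · refine smoothTransition_deriv_of_one_lt ?_
    have := (div_lt_one hR2).2 h
    linarith
  · refine smoothTransition_deriv_of_neg ?_
    have h2 : 2 * R ^ 2 < ‖z.1‖ ^ 2 + z.2 := not_le.1 fun h' => hz ⟨h, h'⟩
    have := (lt_div_iff₀ hR2).2 h2
    linarith

/-- The initial ramp is nondecreasing in time, so it can be dropped from this one-sided bound, which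
therefore does not depend on `a`. One power of the cut-off is given up so that the factor `η^j`
matches the one left by the absorbed flux. -/
theorem neg_timeDeriv_cutoff_pow_le {a R M : ℝ} (ha : 0 < a) (hR : 0 < R)
    (hM : ∀ x, deriv Real.smoothTransition x ≤ M) (j : ℕ) (z : SpaceTime N) :
    -timeDeriv (fun z : SpaceTime N => cutoff a R z ^ (j + 2)) z ≤
      (j + 2) * M / R ^ 2 * (shell N R).indicator (fun z => cutoff a R z ^ j) z := by
  have h1 : HasDerivAt (fun t : ℝ => 2 - (‖z.1‖ ^ 2 + t) / R ^ 2) (-(1 / R ^ 2)) z.2 :=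
    (((hasDerivAt_id z.2).const_add _).div_const _).const_sub 2
  have h2 : HasDerivAt (fun t : ℝ => (t - a) / a) (1 / a) z.2 :=
    ((hasDerivAt_id z.2).sub_const a).div_const a
  have h3 := ((smoothTransition_hasDerivAt _).comp z.2 h1).mul
    ((smoothTransition_hasDerivAt _).comp z.2 h2)
  have h4 : timeDeriv (fun z : SpaceTime N => cutoff a R z ^ (j + 2)) z = _ :=
    (h3.pow (j + 2)).deriv
  have hσ' := smoothTransition_deriv_nonneg ((z.2 - a) / a)
  have hσ := Real.smoothTransition.nonneg ((z.2 - a) / a)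
  have hσ1 := Real.smoothTransition.le_one ((z.2 - a) / a)
  have hχ := Real.smoothTransition.nonneg (2 - (‖z.1‖ ^ 2 + z.2) / R ^ 2)
  have hχ' := smoothTransition_deriv_nonneg (2 - (‖z.1‖ ^ 2 + z.2) / R ^ 2)
  have hη := cutoff_nonneg a R z
  have hη1 := cutoff_le_one a R z
  rw [h4]
  simp only [Pi.mul_apply, Function.comp_apply, Nat.add_succ_sub_one, Nat.cast_add,
    Nat.cast_ofNat]
  change -((j + 2 : ℝ) * cutoff a R z ^ (j + 1) * _) ≤ _
  have hR2 : 0 < R ^ 2 := by positivity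
  have hp : cutoff a R z ^ (j + 1) ≤ cutoff a R z ^ j := pow_le_pow_of_le_one hη hη1 (by simp)
  have hpos : 0 ≤ (j + 2 : ℝ) * cutoff a R z ^ (j + 1) := by positivity
  calc _ ≤ (j + 2 : ℝ) * cutoff a R z ^ (j + 1) *
        (deriv Real.smoothTransition (2 - (‖z.1‖ ^ 2 + z.2) / R ^ 2) / R ^ 2) := by
        rw [← mul_neg]
        -- The ramp contributes the term of sign `e1`; the outer transition contributes `e3`.
        refine mul_le_mul_of_nonneg_left ?_ hpos
        have e1 : 0 ≤ Real.smoothTransition (2 - (‖z.1‖ ^ 2 + z.2) / R ^ 2) *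
            (deriv Real.smoothTransition ((z.2 - a) / a) * (1 / a)) := by positivity
        have e2 : deriv Real.smoothTransition (2 - (‖z.1‖ ^ 2 + z.2) / R ^ 2) / R ^ 2 *
            Real.smoothTransition ((z.2 - a) / a) ≤
            deriv Real.smoothTransition (2 - (‖z.1‖ ^ 2 + z.2) / R ^ 2) / R ^ 2 :=
          mul_le_of_le_one_right (by positivity) hσ1
        have e3 : deriv Real.smoothTransition (2 - (‖z.1‖ ^ 2 + z.2) / R ^ 2) * -(1 / R ^ 2) *
            Real.smoothTransition ((z.2 - a) / a) =
            -(deriv Real.smoothTransition (2 - (‖z.1‖ ^ 2 + z.2) / R ^ 2) / R ^ 2 *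
            Real.smoothTransition ((z.2 - a) / a)) := by ring
        linarith
    _ ≤ _ := by
        by_cases hz : z ∈ shell N R
        · rw [indicator_of_mem hz]
          calc _ ≤ (j + 2 : ℝ) * cutoff a R z ^ j * (M / R ^ 2) := by
                gcongr
                exact hM _
            _ = _ := by ring
        · rw [indicator_of_notMem hz, deriv_smoothTransition_shell hR hz]
          simp

/-- The gradient of `‖x‖² / R²` is `2x / R²`, and `‖x‖ ≤ 2R` on the support: this gives the factor
`4 / R`. -/
theorem norm_spaceGrad_cutoff_pow_le {a R M : ℝ} (ha : 0 < a) (hR : 0 < R)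
    (hM : ∀ x, deriv Real.smoothTransition x ≤ M) (j : ℕ) (z : SpaceTime N) :
    ‖spaceGrad (fun z : SpaceTime N => cutoff a R z ^ (j + 2)) z‖ ≤
      4 * (j + 2) * M / R * (shell N R).indicator (fun z => cutoff a R z ^ (j + 1)) z := by
  set χ' := deriv Real.smoothTransition (2 - (‖z.1‖ ^ 2 + z.2) / R ^ 2) with hχ'
  set σ := Real.smoothTransition ((z.2 - a) / a) with hσ
  have h1 : HasFDerivAt (fun x : Space N => 2 - (‖x‖ ^ 2 + z.2) / R ^ 2)
      (-((R ^ 2)⁻¹ • (2 • innerSL ℝ z.1))) z.1 := by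
    have := (((hasStrictFDerivAt_norm_sq z.1).hasFDerivAt.add_const z.2).mul_const
      (R ^ 2)⁻¹).const_sub 2
    simpa only [div_eq_mul_inv] using this
  have h2 : HasFDerivAt (fun x : Space N => cutoff a R (x, z.2))
      (σ • χ' • (-((R ^ 2)⁻¹ • (2 • innerSL ℝ z.1)) : Space N →L[ℝ] ℝ)) z.1 := by
    have := ((smoothTransition_hasDerivAt _).comp_hasFDerivAt z.1 h1).mul_const σ
    exact this
  have h3 : HasFDerivAt (fun x : Space N => cutoff a R (x, z.2) ^ (j + 2)) _ z.1 := h2.pow (j + 2)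
  have h4 : spaceGrad (fun z : SpaceTime N => cutoff a R z ^ (j + 2)) z =
      (-((j + 2) * cutoff a R z ^ (j + 1) * (σ * χ' * ((R ^ 2)⁻¹ * 2)))) • z.1 := by
    rw [spaceGrad, gradient, h3.fderiv]
    refine ext_inner_right ℝ fun v => ?_
    rw [InnerProductSpace.toDual_symm_apply, inner_smul_left]
    simp
    ring
  rw [h4, norm_smul, Real.norm_eq_abs, abs_neg]
  have hσ0 : 0 ≤ σ := Real.smoothTransition.nonneg _
  have hσ1 : σ ≤ 1 := Real.smoothTransition.le_one _
  have hχ0 : 0 ≤ χ' := smoothTransition_deriv_nonneg _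
  have hη := cutoff_nonneg a R z
  have hM0 : 0 ≤ M := hχ0.trans (hM _)
  rw [abs_of_nonneg (by positivity)]
  by_cases hz : z ∈ shell N R
  · rw [indicator_of_mem hz]
    by_cases h0 : cutoff a R z = 0
    · simp [h0]
    have hx : ‖z.1‖ ≤ 2 * R := by
      simpa using (subset_closedBall_prod_Icc ha hR (mem_of_cutoff_ne_zero ha hR h0)).1
    calc _ ≤ (j + 2) * cutoff a R z ^ (j + 1) * (1 * M * ((R ^ 2)⁻¹ * 2)) * (2 * R) := by
          gcongr
          exact hM _
      _ = _ := by field_simp; ring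
  · rw [indicator_of_notMem hz, hχ', deriv_smoothTransition_shell hR hz]
    simp

/-- No integrability is needed, because the integral of a non-integrable function is `0` by
convention. -/
theorem ofReal_integral_le_lintegral_ofReal {α : Type*} [MeasurableSpace α] {μ : Measure α}
    (f : α → ℝ) : ENNReal.ofReal (∫ x, f x ∂μ) ≤ ∫⁻ x, ENNReal.ofReal (f x) ∂μ := by
  by_cases hf : Integrable f μ
  · rw [integral_eq_lintegral_pos_part_sub_lintegral_neg_part hf]
    exact (ENNReal.ofReal_le_ofReal (sub_le_self _ ENNReal.toReal_nonneg)).trans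
      ENNReal.ofReal_toReal_le
  · simp [integral_undef hf]

/-! ### The flux, the test weight and pointwise absorption -/

theorem norm_meanCurvature_le_one (x : Space N) (s : ℝ) (ξ : Space N) :
    ‖meanCurvature x s ξ‖ ≤ 1 := by
  have h1 : 0 < Real.sqrt (1 + ‖ξ‖ ^ 2) := Real.sqrt_pos.2 (by positivity)
  rw [meanCurvature, norm_smul, Real.norm_eq_abs, abs_of_pos (by positivity), one_div,
    inv_mul_le_iff₀ h1, mul_one]
  exact Real.le_sqrt_of_sq_le (by linarith)

/-- The weak coercivity that drives the absorption: the factor `1 / √(1 + ‖ξ‖²)` is at most `1`, so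
squaring only decreases it. -/
theorem norm_meanCurvature_sq_le (x : Space N) (s : ℝ) (ξ : Space N) :
    ‖meanCurvature x s ξ‖ ^ 2 ≤ inner ℝ (meanCurvature x s ξ) ξ := by
  have h1 : 1 ≤ Real.sqrt (1 + ‖ξ‖ ^ 2) := Real.one_le_sqrt.2 (by nlinarith [sq_nonneg ‖ξ‖])
  rw [meanCurvature, norm_smul, inner_smul_left, real_inner_self_eq_norm_sq, Real.norm_eq_abs,
    abs_of_pos (by positivity), RCLike.conj_to_real, mul_pow]
  have h2 : 1 / Real.sqrt (1 + ‖ξ‖ ^ 2) ≤ 1 := (div_le_one (by positivity)).2 h1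
  have h3 : (1 / Real.sqrt (1 + ‖ξ‖ ^ 2)) ^ 2 ≤ 1 / Real.sqrt (1 + ‖ξ‖ ^ 2) := by
    rw [sq]
    exact mul_le_of_le_one_left (by positivity) h2
  gcongr

/-- The nonlinearity in the test function, at scale `m`. -/
noncomputable def testWeight (α m s : ℝ) : ℝ := 1 + (1 + s / m) ^ (-α)

/-- A primitive of `testWeight`. -/
noncomputable def testPrimitive (α m s : ℝ) : ℝ := s + m / (1 - α) * (1 + s / m) ^ (1 - α)

section TestWeight

variable {α m s : ℝ}

theorem one_le_one_add_div (hm : 0 < m) (hs : 0 ≤ s) : 1 ≤ 1 + s / m :=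
  le_add_of_nonneg_right (by positivity)

theorem hasDerivAt_one_add_div (m s : ℝ) : HasDerivAt (fun s => 1 + s / m) (1 / m) s :=
  ((hasDerivAt_id s).div_const m).const_add 1

theorem hasDerivAt_testWeight (hm : 0 < m) (hs : 0 ≤ s) :
    HasDerivAt (testWeight α m) (-(α / m * (1 + s / m) ^ (-α - 1))) s := by
  have h := ((hasDerivAt_one_add_div m s).rpow_const (p := -α)
    (Or.inl (zero_lt_one.trans_le (one_le_one_add_div hm hs)).ne')).const_add 1
  exact h.congr_deriv (by ring)

theorem hasDerivAt_testPrimitive (hα : α < 1) (hm : 0 < m) (hs : 0 ≤ s) :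
    HasDerivAt (testPrimitive α m) (testWeight α m s) s := by
  have h := (hasDerivAt_id s).add (((hasDerivAt_one_add_div m s).rpow_const (p := 1 - α)
    (Or.inl (zero_lt_one.trans_le (one_le_one_add_div hm hs)).ne')).const_mul (m / (1 - α)))
  refine h.congr_deriv ?_
  have : 1 - α ≠ 0 := by linarith
  have hm' := hm.ne'
  rw [testWeight, show 1 - α - 1 = -α by ring]
  field_simp

theorem contDiffAt_testWeight (hm : 0 < m) (hs : 0 ≤ s) : ContDiffAt ℝ ∞ (testWeight α m) s :=
  contDiffAt_const.add ((contDiffAt_const.add (contDiffAt_id.div_const m)).rpow_const_of_ne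
    (zero_lt_one.trans_le (one_le_one_add_div hm hs)).ne')

theorem contDiffAt_testPrimitive (hm : 0 < m) (hs : 0 ≤ s) :
    ContDiffAt ℝ 1 (testPrimitive α m) s :=
  contDiffAt_id.add (contDiffAt_const.mul
    ((contDiffAt_const.add (contDiffAt_id.div_const m)).rpow_const_of_ne
      (zero_lt_one.trans_le (one_le_one_add_div hm hs)).ne'))

theorem one_le_testWeight (hm : 0 < m) (hs : 0 ≤ s) : 1 ≤ testWeight α m s :=
  le_add_of_nonneg_right (Real.rpow_nonneg (zero_le_one.trans (one_le_one_add_div hm hs)) _)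

theorem testWeight_le_two (hα : 0 ≤ α) (hm : 0 < m) (hs : 0 ≤ s) : testWeight α m s ≤ 2 := by
  have := Real.rpow_le_one_of_one_le_of_nonpos (one_le_one_add_div hm hs) (by linarith : -α ≤ 0)
  rw [testWeight]
  linarith

theorem abs_deriv_testWeight_le (hα : 0 ≤ α) (hm : 0 < m) (hs : 0 ≤ s) :
    |deriv (testWeight α m) s| ≤ α / m := by
  have h1 := Real.rpow_le_one_of_one_le_of_nonpos (one_le_one_add_div hm hs)
    (by linarith : -α - 1 ≤ 0)
  have h2 := Real.rpow_nonneg (zero_le_one.trans (one_le_one_add_div hm hs)) (-α - 1)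
  rw [(hasDerivAt_testWeight hm hs).deriv, abs_neg, abs_of_nonneg (by positivity)]
  exact mul_le_of_le_one_right (by positivity) h1

/-- Pointwise absorption of the flux terms. -/
theorem nonlinear_test_integrand_le (hα : 0 < α) (hα1 : α < 1) (hm : 0 < m) (hs : 0 ≤ s)
    {G D ξ : Space N} (hGD : ‖G‖ ^ 2 ≤ inner ℝ G D) {η T ι b₁ b₂ : ℝ} {j : ℕ} (hη : 0 ≤ η)
    (hι : ι = 0 ∨ ι = 1) (hb₁ : 0 ≤ b₁) (hb₂ : 0 ≤ b₂) (hT : -T ≤ b₁ * (ι * η ^ j))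
    (hξ : ‖ξ‖ ≤ b₂ * (ι * η ^ (j + 1))) :
    -(T * testPrimitive α m s) +
        (deriv (testWeight α m) s * η ^ (j + 2) * inner ℝ G D + testWeight α m s * inner ℝ G ξ) ≤
      m * (b₁ * (1 + 1 / (1 - α)) + b₂ ^ 2 / α) * ((1 + s / m) ^ (1 + α) * (ι * η ^ j)) := by
  have hq1 := one_le_one_add_div hm hs
  set q := 1 + s / m with hq
  have hq0 : 0 < q := zero_lt_one.trans_le hq1
  have hι0 : 0 ≤ ι := by rcases hι with h | h <;> simp [h]
  have h1α : 0 < 1 - α := by linarith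
  -- Here `α < 1` is essential: the nonnegativity of the primitive allows the one-sided bound on
  -- `-T` to be multiplied by it.
  have hP0 : 0 ≤ testPrimitive α m s := by
    have := Real.rpow_nonneg hq0.le (1 - α)
    unfold testPrimitive
    positivity
  have hP : testPrimitive α m s ≤ m * (1 + 1 / (1 - α)) * q ^ (1 + α) := by
    have e1 : s ≤ m * q ^ (1 + α) := by
      have h1 : q ≤ q ^ (1 + α) := Real.self_le_rpow_of_one_le hq1 (by linarith)
      have h2 : s ≤ m * q := by rw [hq, mul_add, mul_div_cancel₀ _ hm.ne']; linarith
      exact h2.trans (by gcongr)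
    have e2 : q ^ (1 - α) ≤ q ^ (1 + α) := Real.rpow_le_rpow_of_exponent_le hq1 (by linarith)
    calc testPrimitive α m s ≤ m * q ^ (1 + α) + m / (1 - α) * q ^ (1 + α) := by
          unfold testPrimitive
          gcongr
      _ = _ := by ring
  have t1 : -(T * testPrimitive α m s) ≤
      m * (b₁ * (1 + 1 / (1 - α))) * (q ^ (1 + α) * (ι * η ^ j)) := by
    calc _ = -T * testPrimitive α m s := by ring
      _ ≤ b₁ * (ι * η ^ j) * (m * (1 + 1 / (1 - α)) * q ^ (1 + α)) := by gcongr
      _ = _ := by ring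
  -- `A = |h'(s)|` is the coefficient of the good term; its inverse, the price of absorption, is a
  -- multiple of `q^(1+α)`, the power that also bounds the primitive.
  set A := α / m * q ^ (-α - 1) with hA
  have hA0 : 0 < A := by have := Real.rpow_pos_of_pos hq0 (-α - 1); positivity
  have hAinv : A⁻¹ = m / α * q ^ (1 + α) := by
    rw [hA, mul_inv, ← Real.rpow_neg hq0.le, inv_div]
    congr 2
    ring
  have t2 : deriv (testWeight α m) s * η ^ (j + 2) * inner ℝ G D ≤
      -(A * η ^ (j + 2) * ‖G‖ ^ 2) := by
    rw [(hasDerivAt_testWeight hm hs).deriv, neg_mul, neg_mul, neg_le_neg_iff]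
    gcongr
  have t3 : testWeight α m s * inner ℝ G ξ ≤ 2 * (‖G‖ * (b₂ * (ι * η ^ (j + 1)))) := by
    have h2 : inner ℝ G ξ ≤ ‖G‖ * (b₂ * (ι * η ^ (j + 1))) :=
      (real_inner_le_norm G ξ).trans (by gcongr)
    have h0 : 0 ≤ testWeight α m s := zero_le_one.trans (one_le_testWeight hm hs)
    have h3 := testWeight_le_two hα.le hm hs
    calc _ ≤ testWeight α m s * (‖G‖ * (b₂ * (ι * η ^ (j + 1)))) := by gcongr
      _ ≤ _ := by gcongr
  have t4 : 2 * (‖G‖ * (b₂ * (ι * η ^ (j + 1)))) ≤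
      A * η ^ (j + 2) * ‖G‖ ^ 2 + m * (b₂ ^ 2 / α) * (q ^ (1 + α) * (ι * η ^ j)) := by
    have e : m * (b₂ ^ 2 / α) * (q ^ (1 + α) * (ι * η ^ j)) = A⁻¹ * b₂ ^ 2 * (ι * η ^ j) := by
      rw [hAinv]; ring
    rw [e]
    rcases hι with h | h
    · rw [h]
      simp only [zero_mul, mul_zero, add_zero]
      positivity
    · rw [h, one_mul, one_mul]
      -- Completing the square; the powers fit because `2(j + 1) = (j + 2) + j`.
      have h5 : 0 ≤ A⁻¹ * (A * η * ‖G‖ - b₂) ^ 2 * η ^ j := by positivity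
      have h6 : A⁻¹ * (A * η * ‖G‖ - b₂) ^ 2 * η ^ j = A * η ^ (j + 2) * ‖G‖ ^ 2 +
          A⁻¹ * b₂ ^ 2 * η ^ j - 2 * (‖G‖ * (b₂ * η ^ (j + 1))) := by
        field_simp
        ring
      linarith
  have t5 : m * (b₁ * (1 + 1 / (1 - α)) + b₂ ^ 2 / α) * (q ^ (1 + α) * (ι * η ^ j)) =
      m * (b₁ * (1 + 1 / (1 - α))) * (q ^ (1 + α) * (ι * η ^ j)) +
        m * (b₂ ^ 2 / α) * (q ^ (1 + α) * (ι * η ^ j)) := by ring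
  rw [t5]
  linarith

/-- Young's inequality with a weight of large power. -/
theorem rpow_mul_pow_le (hα : 0 < α) (hm : 0 < m) (hs : 0 ≤ s) {σ η : ℝ} (hσ : 1 + α ≤ σ)
    {j : ℕ} (hj : ((j : ℝ) + 2) * (1 + α) ≤ j * σ) (hη : 0 ≤ η) (hη1 : η ≤ 1) :
    (1 + s / m) ^ (1 + α) * η ^ j ≤
      2 ^ (1 + α) * (2 + (m ^ σ)⁻¹ * (s ^ σ * η ^ (j + 2))) := by
  have hr : 0 < 1 + α := by linarith
  have hσ0 : 0 < σ := hr.trans_le hσ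
  set x := s / m with hx
  have hx0 : 0 ≤ x := by positivity
  have hj1 : η ^ j ≤ 1 := pow_le_one₀ hη hη1
  have hj0 : 0 ≤ η ^ j := by positivity
  have h1 : (1 + x) ^ (1 + α) ≤ 2 ^ (1 + α) * (1 + x ^ (1 + α)) := by
    rcases le_total x 1 with h | h
    · calc (1 + x) ^ (1 + α) ≤ 2 ^ (1 + α) := by gcongr; linarith
        _ ≤ _ := le_mul_of_one_le_right (by positivity)
          (le_add_of_nonneg_right (Real.rpow_nonneg hx0 _))
    · calc (1 + x) ^ (1 + α) ≤ (2 * x) ^ (1 + α) := by gcongr; linarith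
        _ = 2 ^ (1 + α) * x ^ (1 + α) := Real.mul_rpow (by norm_num) hx0
        _ ≤ _ := by gcongr; linarith
  have h2 : x ^ (1 + α) * η ^ j ≤ 1 + x ^ σ * η ^ (j + 2) := by
    -- The weight is absorbed into the variable so that `y ^ σ` is the target; the assumption on `j`
    -- makes `η^j` at most the weight attached to `y^(1+α)`.
    set y := x * (η ^ (j + 2)) ^ σ⁻¹ with hy
    have hw0 : 0 ≤ η ^ (j + 2) := by positivity
    have hy0 : 0 ≤ y := by positivity
    have e1 : y ^ σ = x ^ σ * η ^ (j + 2) := by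
      rw [hy, Real.mul_rpow hx0 (by positivity), ← Real.rpow_mul hw0, inv_mul_cancel₀ hσ0.ne',
        Real.rpow_one]
    have e2 : η ^ j ≤ ((η ^ (j + 2)) ^ σ⁻¹) ^ (1 + α) := by
      rcases hη.eq_or_lt with h | h
      · have hj0' : j ≠ 0 := by
          rintro rfl
          simp only [CharP.cast_eq_zero, zero_add, zero_mul] at hj
          linarith
        rw [← h, zero_pow hj0']
        positivity
      rw [← Real.rpow_mul hw0, ← Real.rpow_natCast η (j + 2), ← Real.rpow_mul hη,
        ← Real.rpow_natCast]
      refine Real.rpow_le_rpow_of_exponent_ge h hη1 ?_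
      push_cast
      rw [← mul_assoc, mul_comm _ σ⁻¹, mul_assoc, inv_mul_le_iff₀ hσ0]
      linarith
    have e3 : y ^ (1 + α) ≤ 1 + y ^ σ := by
      rcases le_total y 1 with h | h
      · have := Real.rpow_le_one hy0 h hr.le
        have := Real.rpow_nonneg hy0 σ
        linarith
      · have := Real.rpow_le_rpow_of_exponent_le h hσ
        linarith
    calc x ^ (1 + α) * η ^ j ≤ x ^ (1 + α) * ((η ^ (j + 2)) ^ σ⁻¹) ^ (1 + α) := by gcongr
      _ = y ^ (1 + α) := by rw [hy, Real.mul_rpow hx0 (by positivity)]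
      _ ≤ _ := e3
      _ = _ := by rw [e1]
  have h3 : x ^ σ = (m ^ σ)⁻¹ * s ^ σ := by
    rw [hx, Real.div_rpow hs hm.le, div_eq_inv_mul]
  calc (1 + x) ^ (1 + α) * η ^ j ≤ 2 ^ (1 + α) * (1 + x ^ (1 + α)) * η ^ j := by gcongr
    _ = 2 ^ (1 + α) * (η ^ j + x ^ (1 + α) * η ^ j) := by ring
    _ ≤ 2 ^ (1 + α) * (1 + (1 + x ^ σ * η ^ (j + 2))) := by gcongr
    _ = _ := by rw [h3]; ring

end TestWeight

/-! ### The capacity estimate -/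

/-- A measurable nonnegative function satisfying the differential inequality in the open half
space, tested with smooth functions. -/
structure IsInteriorSolution (K : Space N → ℝ) (p q : ℝ) (u ut : SpaceTime N → ℝ)
    (Du : SpaceTime N → Space N) : Prop where
  measurable : Measurable u
  nonneg : ∀ z, 0 ≤ u z
  sobolev : IsSobolevLoc 2 u ut Du
  flux : AEStronglyMeasurable (fun z => meanCurvature z.1 (u z) (Du z))
    (volume.restrict (halfSpace N))
  weak : ∀ φ, IsInteriorTest φ → (∀ z, 0 ≤ φ z) →
    ∫⁻ z in halfSpace N, source K p q u z * ENNReal.ofReal (φ z) ≤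
      ENNReal.ofReal ((∫ z in halfSpace N, ut z * φ z) +
        ∫ z in halfSpace N, inner ℝ (meanCurvature z.1 (u z) (Du z)) (spaceGrad φ z))

/-- A substitute for Cauchy–Schwarz in time that needs no finiteness of `J`. -/
theorem le_add_inv_mul_sq {κ J : ℝ≥0∞} (h0 : κ ≠ 0) (ht : κ ≠ ⊤) :
    J ≤ κ + κ⁻¹ * J ^ 2 := by
  rcases le_total J κ with h | h
  · exact h.trans le_self_add
  · calc J = κ⁻¹ * κ * J := by rw [ENNReal.inv_mul_cancel h0 ht, one_mul]
      _ ≤ κ⁻¹ * J * J := by gcongr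
      _ = κ⁻¹ * J ^ 2 := by ring
      _ ≤ _ := le_add_self

theorem volume_closedBall_prod_Icc {R : ℝ} (hR : 0 < R) :
    volume (Metric.closedBall (0 : Space N) (2 * R) ×ˢ Icc (0 : ℝ) (2 * R ^ 2)) =
      ENNReal.ofReal (2 ^ (N + 1) * (volume (Metric.ball (0 : Space N) 1)).toReal * R ^ (N + 2)) := by
  rw [Measure.volume_eq_prod, Measure.prod_prod, Real.volume_Icc, sub_zero,
    Measure.addHaar_closedBall _ _ (by positivity), finrank_euclideanSpace_fin,
    ← ENNReal.ofReal_toReal (Metric.isBounded_ball.measure_lt_top (μ := volume)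
      (s := Metric.ball (0 : Space N) 1)).ne,
    ← ENNReal.ofReal_mul (by positivity), ← ENNReal.ofReal_mul (by positivity),
    ENNReal.toReal_ofReal ENNReal.toReal_nonneg]
  congr 1
  ring

/-- The density `u ^ σ η ^ (j + 2)` cut off parabolically. -/
noncomputable def cutDensity (σ : ℝ) (j : ℕ) (u : SpaceTime N → ℝ) (a R : ℝ) (z : SpaceTime N) :
    ℝ≥0∞ :=
  ENNReal.ofReal (u z ^ σ * cutoff a R z ^ (j + 2))

theorem measurable_cutDensity {σ : ℝ} {j : ℕ} {u : SpaceTime N → ℝ} (hu : Measurable u)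
    (a R : ℝ) : Measurable (cutDensity σ j u a R) :=
  ((hu.pow_const σ).mul ((contDiff_cutoff a R).continuous.measurable.pow_const _)).ennreal_ofReal

/-- Over a time interval of length `2R²`, the weight `κ = R^N M` gives both parts the order `R^(N+2)
M`: one contributes `2`, the other `1`. -/
theorem lintegral_shell_le {f : SpaceTime N → ℝ≥0∞} (hf : Measurable f) {R M : ℝ} (hR : 0 < R)
    (hM : 0 < M) (hY : ∫⁻ t, (∫⁻ x, f (x, t)) ^ 2 ≤ ENNReal.ofReal ((R ^ (N + 1) * M) ^ 2)) :
    ∫⁻ z in Metric.closedBall (0 : Space N) (2 * R) ×ˢ Icc (0 : ℝ) (2 * R ^ 2), f z ≤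
      ENNReal.ofReal (3 * R ^ (N + 2) * M) := by
  set κ := ENNReal.ofReal (R ^ N * M) with hκ
  have hκ0 : κ ≠ 0 := (ENNReal.ofReal_pos.2 (by positivity)).ne'
  have hκt : κ ≠ ⊤ := ENNReal.ofReal_ne_top
  rw [Measure.volume_eq_prod, ← Measure.prod_restrict, lintegral_prod_symm _ hf.aemeasurable]
  calc _ ≤ ∫⁻ t in Icc (0 : ℝ) (2 * R ^ 2), (κ + κ⁻¹ * (∫⁻ x, f (x, t)) ^ 2) := by
        refine lintegral_mono fun t => ?_
        exact (setLIntegral_le_lintegral _ _).trans (le_add_inv_mul_sq hκ0 hκt)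
    _ = κ * ENNReal.ofReal (2 * R ^ 2) +
        κ⁻¹ * ∫⁻ t in Icc (0 : ℝ) (2 * R ^ 2), (∫⁻ x, f (x, t)) ^ 2 := by
      rw [lintegral_add_left measurable_const, setLIntegral_const, Real.volume_Icc, sub_zero,
        lintegral_const_mul' _ _ (ENNReal.inv_ne_top.2 hκ0)]
    _ ≤ κ * ENNReal.ofReal (2 * R ^ 2) + κ⁻¹ * ENNReal.ofReal ((R ^ (N + 1) * M) ^ 2) := by
      gcongr
      exact (setLIntegral_le_lintegral _ _).trans hY
    _ = _ := by
      rw [hκ, ← ENNReal.ofReal_inv_of_pos (by positivity), ← ENNReal.ofReal_mul (by positivity),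
        ← ENNReal.ofReal_mul (by positivity), ← ENNReal.ofReal_add (by positivity) (by positivity)]
      congr 1
      field_simp
      ring

/-- The basic capacity estimate, at an arbitrary scale `m` of the solution. -/
theorem exists_capacity_bound {p q σ α : ℝ} (hα : 0 < α) (hα1 : α < 1) (hσ : 1 + α ≤ σ) {j : ℕ}
    (hj : ((j : ℝ) + 2) * (1 + α) ≤ j * σ) :
    ∃ C > 0, ∀ {K : Space N → ℝ} {u ut : SpaceTime N → ℝ} {Du : SpaceTime N → Space N},
      IsInteriorSolution K p q u ut Du → ∀ {a R m : ℝ}, 0 < a → 0 < R → 0 < m →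
      ∫⁻ t, (∫⁻ x, (shell N R).indicator (cutDensity σ j u a R) (x, t)) ^ 2 ≤
        ENNReal.ofReal ((R ^ (N + 1) * m ^ σ) ^ 2) →
      ∫⁻ z in halfSpace N, source K p q u z * ENNReal.ofReal (cutoff a R z ^ (j + 2)) ≤
        ENNReal.ofReal (C * R ^ N * m) := by
  obtain ⟨M, hM, hMd⟩ := exists_smoothTransition_deriv_le
  have h1α : 0 < 1 - α := by linarith
  -- The time derivative of the cut-off enters linearly and the gradient squared; with parabolic
  -- scaling both are of order `R⁻²`, and `c` collects their coefficients.
  set c := (j + 2) * M * (1 + 1 / (1 - α)) + (4 * (j + 2) * M) ^ 2 / α with hc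
  set v₁ := (volume (Metric.ball (0 : Space N) 1)).toReal with hv
  have hv0 : 0 ≤ v₁ := ENNReal.toReal_nonneg
  have hc0 : 0 < c := by positivity
  refine ⟨c * 2 ^ (1 + α) * (2 ^ (N + 2) * v₁ + 3), by positivity,
    fun {K u ut Du} hu {a R m} ha hR hm hY => ?_⟩
  obtain ⟨hφ, hφQ⟩ := isInteriorTest_cutoff_pow (N := N) ha hR (k := j + 2) (by simp)
  set φ : SpaceTime N → ℝ := fun z => cutoff a R z ^ (j + 2) with hφdef
  set Q := Metric.closedBall (0 : Space N) (2 * R) ×ˢ Icc (0 : ℝ) (2 * R ^ 2) with hQ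
  set f := (shell N R).indicator (cutDensity σ j u a R) with hf
  have hfm : Measurable f := (measurable_cutDensity hu.measurable a R).indicator
    (measurableSet_shell R)
  set E := m * (c / R ^ 2) * 2 ^ (1 + α) with hE
  have hE0 : 0 < E := by positivity
  have hmσ : 0 < m ^ σ := Real.rpow_pos_of_pos hm σ
  have h1 := lintegral_source_le_of_nonlinear_test (G := fun z => meanCurvature z.1 (u z) (Du z))
    hu.sobolev hu.nonneg hu.flux (fun z => norm_meanCurvature_le_one _ _ _) hu.weak
    (h := testWeight α m) (H := testPrimitive α m) (M := max 2 (α / m))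
    (fun s hs => contDiffAt_testWeight hm hs) (fun s hs => contDiffAt_testPrimitive hm hs)
    (fun s hs => hasDerivAt_testPrimitive hα1 hm hs) (fun s hs => one_le_testWeight hm hs)
    (fun s hs => (testWeight_le_two hα.le hm hs).trans (le_max_left _ _))
    (fun s hs => (abs_deriv_testWeight_le hα.le hm hs).trans (le_max_right _ _)) hφ
    (fun z => pow_nonneg (cutoff_nonneg a R z) _)
  refine h1.trans ((ofReal_integral_le_lintegral_ofReal _).trans ?_)
  have hpt : ∀ z, ENNReal.ofReal (-(timeDeriv φ z * testPrimitive α m (u z)) +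
      (deriv (testWeight α m) (u z) * φ z * inner ℝ (meanCurvature z.1 (u z) (Du z)) (Du z) +
        testWeight α m (u z) * inner ℝ (meanCurvature z.1 (u z) (Du z)) (spaceGrad φ z))) ≤
      ENNReal.ofReal (E * 2) + ENNReal.ofReal (E * (m ^ σ)⁻¹) * f z := fun z => by
    have hη := cutoff_nonneg a R z
    have hη1 := cutoff_le_one a R z
    have e1 : ∀ k : ℕ, (shell N R).indicator (fun z => cutoff a R z ^ k) z =
        (shell N R).indicator (fun _ => 1) z * cutoff a R z ^ k := fun k => by
      by_cases hz : z ∈ shell N R <;> simp [hz]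
    have hι : (shell N R).indicator (fun _ => (1 : ℝ)) z = 0 ∨
        (shell N R).indicator (fun _ => (1 : ℝ)) z = 1 := by
      by_cases hz : z ∈ shell N R <;> simp [hz]
    have hT := neg_timeDeriv_cutoff_pow_le ha hR hMd j z
    have hξ := norm_spaceGrad_cutoff_pow_le ha hR hMd j z
    rw [e1] at hT hξ
    have h2 := nonlinear_test_integrand_le hα hα1 hm (hu.nonneg z)
      (norm_meanCurvature_sq_le z.1 (u z) (Du z)) hη hι (by positivity) (by positivity) hT hξ
    have h3 := rpow_mul_pow_le hα hm (hu.nonneg z) hσ hj hη hη1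
    have hus := Real.rpow_nonneg (hu.nonneg z) σ
    have e2 : m * ((j + 2) * M / R ^ 2 * (1 + 1 / (1 - α)) + (4 * (j + 2) * M / R) ^ 2 / α) =
        m * (c / R ^ 2) := by
      rw [hc]; field_simp
    rw [e2] at h2
    refine (ENNReal.ofReal_le_ofReal h2).trans ?_
    by_cases hz : z ∈ shell N R
    · rw [hf, indicator_of_mem hz, indicator_of_mem hz, one_mul, cutDensity,
        ← ENNReal.ofReal_mul (by positivity), ← ENNReal.ofReal_add (by positivity) (by positivity)]
      refine ENNReal.ofReal_le_ofReal ?_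
      calc _ ≤ m * (c / R ^ 2) *
            (2 ^ (1 + α) * (2 + (m ^ σ)⁻¹ * (u z ^ σ * cutoff a R z ^ (j + 2)))) := by gcongr
        _ = _ := by rw [hE]; ring
    · rw [indicator_of_notMem hz]
      simp
  calc _ ≤ ∫⁻ z in tsupport φ, (ENNReal.ofReal (E * 2) + ENNReal.ofReal (E * (m ^ σ)⁻¹) * f z) :=
        lintegral_mono hpt
    _ ≤ ∫⁻ z in Q, (ENNReal.ofReal (E * 2) + ENNReal.ofReal (E * (m ^ σ)⁻¹) * f z) :=
      lintegral_mono_set hφQ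
    _ = ENNReal.ofReal (E * 2) * volume Q + ENNReal.ofReal (E * (m ^ σ)⁻¹) * ∫⁻ z in Q, f z := by
      rw [lintegral_add_left measurable_const, setLIntegral_const, lintegral_const_mul _ hfm]
    _ ≤ ENNReal.ofReal (E * 2) * ENNReal.ofReal (2 ^ (N + 1) * v₁ * R ^ (N + 2)) +
        ENNReal.ofReal (E * (m ^ σ)⁻¹) * ENNReal.ofReal (3 * R ^ (N + 2) * m ^ σ) := by
      rw [hQ, volume_closedBall_prod_Icc hR]
      gcongr
      exact lintegral_shell_le hfm hR hmσ hY
    _ = _ := by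
      rw [← ENNReal.ofReal_mul (by positivity), ← ENNReal.ofReal_mul (by positivity),
        ← ENNReal.ofReal_add (by positivity) (by positivity)]
      congr 1
      rw [hE]
      field_simp
      ring

/-! ### Limits of the mixed energy -/

/-- The mixed norm of the parabolically cut-off density. -/
noncomputable def cutEnergy (f : SpaceTime N → ℝ≥0∞) : ℝ≥0∞ := ∫⁻ t, (∫⁻ x, f (x, t)) ^ 2

theorem cutEnergy_mono {f g : SpaceTime N → ℝ≥0∞} (h : ∀ z, f z ≤ g z) :
    cutEnergy f ≤ cutEnergy g := by
  unfold cutEnergy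
  gcongr
  exact h _

theorem tendsto_cutEnergy_of_monotone {f : ℕ → SpaceTime N → ℝ≥0∞} {g : SpaceTime N → ℝ≥0∞}
    (hf : ∀ n, Measurable (f n)) (hmono : ∀ z, Monotone fun n => f n z)
    (hlim : ∀ z, Tendsto (fun n => f n z) atTop (𝓝 (g z))) :
    Tendsto (fun n => cutEnergy (f n)) atTop (𝓝 (cutEnergy g)) := by
  have hmono' : ∀ t, Monotone fun n => ∫⁻ x : Space N, f n (x, t) := fun t m n hmn =>
    lintegral_mono fun x => hmono _ hmn
  have hJ : ∀ t, Tendsto (fun n => ∫⁻ x : Space N, f n (x, t)) atTop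
      (𝓝 (∫⁻ x : Space N, g (x, t))) := fun t =>
    lintegral_tendsto_of_tendsto_of_monotone
      (fun n => ((hf n).comp measurable_prodMk_right).aemeasurable)
      (Eventually.of_forall fun x => hmono _) (Eventually.of_forall fun x => hlim _)
  refine lintegral_tendsto_of_tendsto_of_monotone
    (fun n => ((hf n).lintegral_prod_left'.pow_const 2).aemeasurable)
    (Eventually.of_forall fun t m n hmn => ?_)
    (Eventually.of_forall fun t => ENNReal.Tendsto.pow (hJ t))
  exact pow_le_pow_left' (hmono' t hmn) 2

/-- Dominated convergence is used first in `x`, then in `t`; finite energy of the majorant makes its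
spatial integral finite at almost every time. -/
theorem tendsto_cutEnergy_zero_of_dominated {f : ℕ → SpaceTime N → ℝ≥0∞}
    {g : SpaceTime N → ℝ≥0∞} (hf : ∀ n, Measurable (f n)) (hg : Measurable g)
    (hfg : ∀ n z, f n z ≤ g z) (hfin : cutEnergy g ≠ ⊤)
    (hlim : ∀ z, Tendsto (fun n => f n z) atTop (𝓝 0)) :
    Tendsto (fun n => cutEnergy (f n)) atTop (𝓝 0) := by
  have hgm : Measurable fun t => (∫⁻ x : Space N, g (x, t)) ^ 2 :=
    hg.lintegral_prod_left'.pow_const 2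
  have h0 : (0 : ℝ≥0∞) = ∫⁻ _ : ℝ, 0 := by simp
  rw [h0]
  refine tendsto_lintegral_of_dominated_convergence (fun t => (∫⁻ x : Space N, g (x, t)) ^ 2)
    (fun n => (hf n).lintegral_prod_left'.pow_const 2)
    (fun n => Eventually.of_forall fun t => ?_) hfin ?_
  · exact pow_le_pow_left' (lintegral_mono fun x => hfg n _) 2
  · filter_upwards [ae_lt_top hgm hfin] with t ht
    have ht' : ∫⁻ x : Space N, g (x, t) ≠ ⊤ := fun h => by simp [h] at ht
    have h1 : Tendsto (fun n => ∫⁻ x : Space N, f n (x, t)) atTop (𝓝 (∫⁻ _ : Space N, 0)) :=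
      tendsto_lintegral_of_dominated_convergence (fun x => g (x, t))
        (fun n => (hf n).comp measurable_prodMk_right)
        (fun n => Eventually.of_forall fun x => hfg n _) ht'
        (Eventually.of_forall fun x => hlim _)
    simpa using ENNReal.Tendsto.pow (n := 2) h1

theorem ae_eq_zero_of_cutEnergy_eq_zero {g : SpaceTime N → ℝ≥0∞} (hg : Measurable g)
    (h : cutEnergy g = 0) : ∀ᵐ z, g z = 0 := by
  have h1 := (lintegral_eq_zero_iff (hg.lintegral_prod_left'.pow_const 2)).1 h
  have h2 : ∫⁻ z, g z = 0 := by
    rw [Measure.volume_eq_prod, lintegral_prod_symm _ hg.aemeasurable]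
    refine (lintegral_eq_zero_iff hg.lintegral_prod_left').2 ?_
    filter_upwards [h1] with t ht
    simpa using ht
  exact (lintegral_eq_zero_iff hg).1 h2

/-! ### Self-improvement of the energy bound and vanishing -/

section Decay

variable {K : Space N → ℝ} {p q β : ℝ} {u ut : SpaceTime N → ℝ} {Du : SpaceTime N → Space N}

/-- The scale-invariant form of the capacity estimate in the range of exponents at hand. -/
theorem IsInteriorSolution.exists_energy_bound [NullSingletonClass (volume : Measure (Space N))]
    (hu : IsInteriorSolution K p q u ut Du) (hK : IsAdmissibleKernel β K) (hβ : 0 < β)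
    (hp : 0 < p) (hq : 0 < q) {σ α : ℝ} (hσpq : σ = (p + q) / 2)
    (hcrit : σ * (N + β) ≤ N + 1) (hα : 0 < α) (hα1 : α < 1) (hσ : 1 + α ≤ σ) {j : ℕ}
    (hj : ((j : ℝ) + 2) * (1 + α) ≤ j * σ) :
    ∃ C > 0, ∀ {a R y : ℝ}, 0 < a → 1 ≤ R → cutEnergy (cutDensity σ j u a R) ≠ ⊤ ∧
      (0 < y → cutEnergy ((shell N R).indicator (cutDensity σ j u a R)) ≤
        ENNReal.ofReal ((y ^ σ) ^ 2) →
      cutEnergy (cutDensity σ j u a R) ≤ ENNReal.ofReal (C * y)) := by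
  obtain ⟨C, hC, hcap⟩ := exists_capacity_bound (N := N) (p := p) (q := q) hα hα1 hσ hj
  obtain ⟨c, hc, hKc⟩ := hK.exists_pos_mul_rpow_le hβ
  refine ⟨C / c, by positivity, fun {a R y} ha hR => ?_⟩
  have hR0 : 0 < R := by linarith
  have hσ0 : 0 < σ := by linarith
  have hRβ : 0 < R ^ (-β) := Real.rpow_pos_of_pos hR0 _
  have hlow : ENNReal.ofReal (c * R ^ (-β)) * cutEnergy (cutDensity σ j u a R) ≤
      ∫⁻ z in halfSpace N, source K p q u z * ENNReal.ofReal (cutoff a R z ^ (j + 2)) := by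
    have := lintegral_sq_le_lintegral_source (K := K) (p := p) (q := q) (r := 2 * R)
      (φ := fun z => cutoff a R z ^ (j + 2)) (by positivity)
      (fun x hx hxR => hKc R hR x hx (by linarith)) hu.measurable hu.nonneg
      ((contDiff_cutoff a R).continuous.measurable.pow_const _)
      (fun z => pow_nonneg (cutoff_nonneg a R z) _)
      (fun z => pow_le_one₀ (cutoff_nonneg a R z) (cutoff_le_one a R z))
      (fun z hz => by
        have hm := mem_of_cutoff_ne_zero ha hR0 (z := z) fun h => hz (by simp [h])
        refine ⟨⟨mem_univ _, ha.trans_le hm.1⟩, ?_⟩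
        simpa using (subset_closedBall_prod_Icc ha hR0 hm).1) hp hq
    rw [hσpq]
    exact this
  have hd0 : ENNReal.ofReal (c * R ^ (-β)) ≠ 0 := (ENNReal.ofReal_pos.2 (by positivity)).ne'
  constructor
  -- Infinite energy would make the source integral infinite, while the weak inequality bounds it by
  -- a real number.
  · intro htop
    rw [htop, ENNReal.mul_top hd0, top_le_iff] at hlow
    have := hu.weak _ (isInteriorTest_cutoff_pow (N := N) ha hR0 (k := j + 2) (by simp)).1
      (fun z => pow_nonneg (cutoff_nonneg a R z) _)
    rw [hlow] at this
    exact ENNReal.ofReal_ne_top (top_le_iff.1 this)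
  · intro hy hY
    -- The scale is chosen so that `R^(N+1) m^σ = y^σ`, which removes `R` from the hypothesis on the
    -- shell.
    set m := y * R ^ (-((N + 1 : ℝ) / σ)) with hm
    have hm0 : 0 < m := by positivity
    have hmσ : R ^ (N + 1) * m ^ σ = y ^ σ := by
      rw [hm, Real.mul_rpow hy.le (by positivity), ← Real.rpow_mul hR0.le, neg_mul,
        div_mul_cancel₀ _ hσ0.ne', Real.rpow_neg hR0.le,
        show R ^ (N + 1) = R ^ ((N : ℝ) + 1) by exact_mod_cast (Real.rpow_natCast R (N + 1)).symm]
      have : R ^ ((N : ℝ) + 1) ≠ 0 := (Real.rpow_pos_of_pos hR0 _).ne'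
      field_simp
    have hup := hcap hu ha hR0 hm0 (by rw [hmσ]; exact hY)
    have h1 := hlow.trans hup
    rw [mul_comm, ← ENNReal.le_div_iff_mul_le (Or.inl hd0) (Or.inl ENNReal.ofReal_ne_top),
      ← ENNReal.ofReal_div_of_pos (by positivity)] at h1
    refine h1.trans (ENNReal.ofReal_le_ofReal ?_)
    rw [div_le_iff₀ (by positivity)]
    -- The only use of the critical exponent: `σ (N + β) ≤ N + 1` makes the net power of `R`
    -- nonpositive, and equality is allowed.
    have h2 : R ^ (N : ℝ) * R ^ (-((N + 1 : ℝ) / σ)) ≤ R ^ (-β) := by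
      rw [← Real.rpow_add hR0]
      refine Real.rpow_le_rpow_of_exponent_le hR ?_
      have : (N : ℝ) + β ≤ (N + 1) / σ := by
        rw [le_div_iff₀ hσ0]
        linarith
      linarith
    rw [Real.rpow_natCast] at h2
    calc C * R ^ N * m = C * y * (R ^ N * R ^ (-((N + 1 : ℝ) / σ))) := by rw [hm]; ring
      _ ≤ C * y * R ^ (-β) := by gcongr
      _ = _ := by field_simp

/-- The choice `y = X^(1/(2σ))` turns the implication into `y^(2σ) ≤ C y`. If `y > max 1 C`, then
`y^(2σ) ≥ y² > C y`, a contradiction; hence `y ≤ max 1 C`. -/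
theorem le_of_self_bound {X : ℝ≥0∞} {C σ : ℝ} (hC : 0 < C) (hσ : 1 ≤ σ) (hX : X ≠ ⊤)
    (h : ∀ y : ℝ, 0 < y → X ≤ ENNReal.ofReal ((y ^ σ) ^ 2) → X ≤ ENNReal.ofReal (C * y)) :
    X ≤ ENNReal.ofReal (C * max 1 C) := by
  by_cases h0 : X = 0
  · simp [h0]
  have hx : 0 < X.toReal := ENNReal.toReal_pos h0 hX
  set y := X.toReal ^ (1 / (2 * σ)) with hy
  have hy0 : 0 < y := Real.rpow_pos_of_pos hx _
  have hσ0 : σ ≠ 0 := by positivity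
  have hyx : (y ^ σ) ^ 2 = X.toReal := by
    rw [hy, ← Real.rpow_mul hx.le, ← Real.rpow_natCast, ← Real.rpow_mul hx.le]
    rw [show 1 / (2 * σ) * σ * ((2 : ℕ) : ℝ) = 1 by push_cast; field_simp, Real.rpow_one]
  have h1 := h y hy0 (by rw [hyx, ENNReal.ofReal_toReal hX])
  refine h1.trans (ENNReal.ofReal_le_ofReal ?_)
  gcongr
  by_contra! hcon
  rw [max_lt_iff] at hcon
  have h2 : X.toReal ≤ C * y := ENNReal.toReal_le_of_le_ofReal (by positivity) h1
  have h3 : y ≤ y ^ σ := Real.self_le_rpow_of_one_le hcon.1.le hσ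
  nlinarith

/-- The energy implication is used twice: comparing the shell with the whole support gives a bound
uniform in the radius, and then the vanishing of the tail energy lets `y` tend to `0`. -/
theorem IsInteriorSolution.ae_eq_zero_of_lt [NullSingletonClass (volume : Measure (Space N))]
    (hu : IsInteriorSolution K p q u ut Du) (hK : IsAdmissibleKernel β K) (hβ : 0 < β)
    (hp : 0 < p) (hq : 0 < q) {σ α : ℝ} (hσpq : σ = (p + q) / 2)
    (hcrit : σ * (N + β) ≤ N + 1) (hα : 0 < α) (hα1 : α < 1) (hσ : 1 + α ≤ σ) {j : ℕ}
    (hj : ((j : ℝ) + 2) * (1 + α) ≤ j * σ) {a : ℝ} (ha : 0 < a) :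
    ∀ᵐ z, a < z.2 → u z = 0 := by
  obtain ⟨C, hC, hbd⟩ := hu.exists_energy_bound hK hβ hp hq hσpq hcrit hα hα1 hσ hj
  -- The limit of the cut-off densities as `R → ∞`; only the initial ramp remains, and it is
  -- positive for `t > a`.
  set g : SpaceTime N → ℝ≥0∞ := fun z =>
    ENNReal.ofReal (u z ^ σ * Real.smoothTransition ((z.2 - a) / a) ^ (j + 2)) with hg
  have hgm : Measurable g := by
    refine ((hu.measurable.pow_const σ).mul (Measurable.pow_const ?_ _)).ennreal_ofReal
    exact Real.smoothTransition.continuous.measurable.comp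
      ((measurable_snd.sub_const a).div_const a)
  set A : ℕ → Set (SpaceTime N) := fun n => {z | (n : ℝ) ^ 2 ≤ ‖z.1‖ ^ 2 + z.2} with hA
  have hAm : ∀ n, MeasurableSet (A n) := fun n =>
    (isClosed_le (by fun_prop) (by fun_prop)).measurableSet
  have hcut_le : ∀ R z, cutDensity σ j u a R z ≤ g z := fun R z => by
    refine ENNReal.ofReal_le_ofReal ?_
    have := Real.rpow_nonneg (hu.nonneg z) σ
    gcongr
    · exact cutoff_nonneg a R z
    · exact mul_le_of_le_one_left (Real.smoothTransition.nonneg _) (Real.smoothTransition.le_one _)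
  have hcut_eq : ∀ n : ℕ, 1 ≤ n → ∀ z, (A n)ᶜ.indicator g z ≤ cutDensity σ j u a n z :=
      fun n hn z => by
    by_cases hz : z ∈ (A n)ᶜ
    · rw [indicator_of_mem hz, cutDensity, cutoff, Real.smoothTransition.one_of_one_le, one_mul]
      have hn' : (0 : ℝ) < (n : ℝ) ^ 2 := by positivity
      have : (‖z.1‖ ^ 2 + z.2) / (n : ℝ) ^ 2 ≤ 1 := (div_le_one hn').2 (not_le.1 (show ¬(n : ℝ) ^ 2 ≤ ‖z.1‖ ^ 2 + z.2 from hz)).le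
      linarith
    · rw [indicator_of_notMem hz]
      exact zero_le
  have hAlim : ∀ z, ∀ᶠ n in atTop, z ∉ A n := fun z => by
    have h1 : Tendsto (fun n : ℕ => (n : ℝ) ^ 2) atTop atTop :=
      (tendsto_pow_atTop two_ne_zero).comp tendsto_natCast_atTop_atTop
    filter_upwards [h1.eventually_gt_atTop (‖z.1‖ ^ 2 + z.2)] with n hn using not_le.2 hn
  have hAanti : ∀ m n, m ≤ n → A n ⊆ A m := fun m n hmn z hz => by
    have : (m : ℝ) ^ 2 ≤ (n : ℝ) ^ 2 := by gcongr
    exact this.trans hz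
  have hlimX : Tendsto (fun n => cutEnergy ((A n)ᶜ.indicator g)) atTop (𝓝 (cutEnergy g)) := by
    refine tendsto_cutEnergy_of_monotone (fun n => hgm.indicator (hAm n).compl)
      (fun z m n hmn => ?_) (fun z => ?_)
    · exact indicator_le_indicator_of_subset (compl_subset_compl.2 (hAanti m n hmn))
        (fun _ => zero_le) z
    · refine tendsto_const_nhds.congr' ?_
      filter_upwards [hAlim z] with n hn
      rw [indicator_of_mem hn]
  -- First pass: the shell energy is at most the full energy, so the latter satisfies the
  -- self-bound.
  have hfin : cutEnergy g ≤ ENNReal.ofReal (C * max 1 C) := by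
    refine le_of_tendsto hlimX ?_
    filter_upwards [eventually_ge_atTop 1] with n hn
    have hn1 : (1 : ℝ) ≤ n := by exact_mod_cast hn
    refine (cutEnergy_mono (hcut_eq n hn)).trans
      (le_of_self_bound hC (by linarith) (hbd (y := 0) ha hn1).1 fun y hy hX =>
        (hbd ha hn1).2 hy (le_trans (cutEnergy_mono fun z => ?_) hX))
    exact indicator_le_self _ _ z
  have hlimY : Tendsto (fun n => cutEnergy ((A n).indicator g)) atTop (𝓝 0) := by
    refine tendsto_cutEnergy_zero_of_dominated (fun n => hgm.indicator (hAm n)) hgm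
      (fun n z => indicator_le_self _ _ z) (ne_top_of_le_ne_top ENNReal.ofReal_ne_top hfin)
      (fun z => ?_)
    refine tendsto_const_nhds.congr' ?_
    filter_upwards [hAlim z] with n hn
    rw [indicator_of_notMem hn]
  -- Second pass: the shell lies in the tail `A n`, whose energy eventually drops below any
  -- prescribed `y^(2σ)`.
  have hε : ∀ y : ℝ, 0 < y → cutEnergy g ≤ ENNReal.ofReal (C * y) := fun y hy => by
    refine le_of_tendsto hlimX ?_
    have hpos : 0 < ENNReal.ofReal ((y ^ σ) ^ 2) := ENNReal.ofReal_pos.2 (by positivity)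
    filter_upwards [eventually_ge_atTop 1, hlimY.eventually_le_const hpos] with n hn hY
    have hn1 : (1 : ℝ) ≤ n := by exact_mod_cast hn
    refine (cutEnergy_mono (hcut_eq n hn)).trans
      ((hbd ha hn1).2 hy (le_trans (cutEnergy_mono fun z => ?_) hY))
    refine indicator_le_indicator' (fun hz => hcut_le _ z) |>.trans ?_
    exact indicator_le_indicator_of_subset (fun z hz => hz.1) (fun _ => zero_le) z
  have hzero : cutEnergy g = 0 := by
    have ht : Tendsto (fun y : ℝ => ENNReal.ofReal (C * y)) (𝓝[>] 0) (𝓝 0) := by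
      have : Tendsto (fun y : ℝ => ENNReal.ofReal (C * y)) (𝓝 0) (𝓝 (ENNReal.ofReal (C * 0))) :=
        ENNReal.tendsto_ofReal (tendsto_id.const_mul C)
      rw [mul_zero, ENNReal.ofReal_zero] at this
      exact this.mono_left nhdsWithin_le_nhds
    refine le_antisymm (ge_of_tendsto ht ?_) zero_le
    filter_upwards [self_mem_nhdsWithin] with y hy using hε y hy
  filter_upwards [ae_eq_zero_of_cutEnergy_eq_zero hgm hzero] with z hz hza
  rw [hg] at hz
  simp only [ENNReal.ofReal_eq_zero] at hz
  by_contra hne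
  have h1 : 0 < u z := lt_of_le_of_ne (hu.nonneg z) (Ne.symm hne)
  have h2 : 0 < Real.smoothTransition ((z.2 - a) / a) :=
    Real.smoothTransition.pos_of_pos (div_pos (by linarith) ha)
  have h3 : 0 < u z ^ σ * Real.smoothTransition ((z.2 - a) / a) ^ (j + 2) := by positivity
  linarith

/-- The Liouville property for measurable nonnegative solutions in the interior. -/
theorem IsInteriorSolution.ae_eq_zero (hN : 1 ≤ N) (hu : IsInteriorSolution K p q u ut Du)
    (hK : IsAdmissibleKernel β K) (hβ : 0 < β) (hp : 0 < p) (hq : 0 < q) (hpq : 2 < p + q)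
    (hpq' : p + q ≤ 2 + 2 * (1 - β) / ((N : ℝ) + β)) :
    ∀ᵐ z ∂(volume.restrict (halfSpace N)), u z = 0 := by
  -- For `N ≥ 1` points of `Space N` are null, so the value of `K` at `0` does not matter.
  have : Nonempty (Fin N) := ⟨⟨0, hN⟩⟩
  have hNβ : 0 < (N : ℝ) + β := by positivity
  obtain ⟨σ, hσ⟩ : ∃ σ, σ = (p + q) / 2 := ⟨_, rfl⟩
  have hσ1 : 1 < σ := by linarith
  have hcrit : σ * (N + β) ≤ N + 1 := by
    have h1 : (p + q) * (N + β) ≤ (2 + 2 * (1 - β) / ((N : ℝ) + β)) * (N + β) := by gcongr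
    rw [add_mul (2 : ℝ), div_mul_cancel₀ _ hNβ.ne'] at h1
    rw [hσ]
    linarith
  -- The strict inequality `1 + α < σ` leaves the gap that a large power `j` of the cut-off
  -- exploits.
  obtain ⟨α, hα, hα1, hασ⟩ : ∃ α : ℝ, 0 < α ∧ α < 1 ∧ 1 + α < σ := by
    refine ⟨min (1 / 2) ((σ - 1) / 2), ?_, ?_, ?_⟩
    · exact lt_min (by norm_num) (by linarith)
    · exact (min_le_left _ _).trans_lt (by norm_num)
    · have := min_le_right (1 / 2) ((σ - 1) / 2)
      linarith
  obtain ⟨j, hj⟩ := exists_nat_ge (2 * (1 + α) / (σ - (1 + α)))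
  have hj' : ((j : ℝ) + 2) * (1 + α) ≤ j * σ := by
    rw [div_le_iff₀ (by linarith)] at hj
    linarith
  have hn : ∀ᵐ z : SpaceTime N, ∀ n : ℕ, 1 / ((n : ℝ) + 1) < z.2 → u z = 0 :=
    ae_all_iff.2 fun n =>
      hu.ae_eq_zero_of_lt hK hβ hp hq hσ hcrit hα hα1 hασ.le hj' (by positivity)
  rw [ae_restrict_iff' measurableSet_halfSpace]
  filter_upwards [hn] with z hz hzh
  obtain ⟨n, hn⟩ := exists_nat_one_div_lt (show 0 < z.2 from hzh.2)
  exact hz n hn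

end Decay

/-! ### Measurable representatives and the two weak formulations -/

theorem exists_compact_exhaustion_halfSpace :
    ∃ C : ℕ → Set (SpaceTime N), (∀ n, IsCompact (C n)) ∧ (∀ n, C n ⊆ halfSpace N) ∧
      halfSpace N = ⋃ n, C n := by
  have hsub : ∀ n : ℕ, Metric.closedBall (0 : Space N) n ×ˢ Icc (1 / ((n : ℝ) + 1)) n ⊆
      halfSpace N := fun n z hz =>
    ⟨mem_univ _, lt_of_lt_of_le (by positivity : (0 : ℝ) < 1 / ((n : ℝ) + 1)) hz.2.1⟩
  refine ⟨fun n => Metric.closedBall 0 n ×ˢ Icc (1 / ((n : ℝ) + 1)) n,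
    fun n => (isCompact_closedBall _ _).prod isCompact_Icc, hsub,
    Subset.antisymm (fun z hz => ?_) (iUnion_subset hsub)⟩
  obtain ⟨k, hk⟩ := exists_nat_one_div_lt (show 0 < z.2 from hz.2)
  obtain ⟨l, hl⟩ := exists_nat_ge (max ‖z.1‖ z.2)
  refine mem_iUnion.2 ⟨max k l, ?_, ?_, ?_⟩
  · rw [mem_closedBall_zero_iff]
    exact (le_max_left _ _).trans (hl.trans (by exact_mod_cast le_max_right k l))
  · refine le_trans ?_ hk.le
    have : (k : ℝ) ≤ (max k l : ℕ) := by exact_mod_cast le_max_left k l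
    gcongr
  · exact (le_max_right _ _).trans (hl.trans (by exact_mod_cast le_max_right k l))

theorem MemLrLoc.aestronglyMeasurable {F : Type*} [NormedAddCommGroup F] {r : ℝ}
    {f : SpaceTime N → F} (hf : MemLrLoc r f) :
    AEStronglyMeasurable f (volume.restrict (halfSpace N)) := by
  obtain ⟨C, hC, hCh, hU⟩ := exists_compact_exhaustion_halfSpace (N := N)
  rw [hU, aestronglyMeasurable_iUnion_iff]
  exact fun n => (hf (C n) (hC n) (hCh n)).aestronglyMeasurable

/-- The convolution depends on a whole time slice, so equality at almost every point is not enough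
by itself: by Fubini, at almost every time the two slices agree almost everywhere. -/
theorem source_congr_ae {K : Space N → ℝ} {p q : ℝ} {u v : SpaceTime N → ℝ}
    (h : u =ᵐ[volume.restrict (halfSpace N)] v) :
    source K p q u =ᵐ[volume.restrict (halfSpace N)] source K p q v := by
  have h1 := (ae_restrict_iff' measurableSet_halfSpace).1 h
  have h2 : ∀ᵐ w : ℝ × Space N, w.swap ∈ halfSpace N → u w.swap = v w.swap :=
    (Measure.measurePreserving_swap (μ := (volume : Measure ℝ))
      (ν := (volume : Measure (Space N)))).quasiMeasurePreserving.ae h1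
  have h3 : ∀ᵐ t : ℝ, ∀ᵐ x : Space N, (x, t) ∈ halfSpace N → u (x, t) = v (x, t) :=
    Measure.ae_ae_of_ae_prod h2
  have h4 : ∀ᵐ z : SpaceTime N, ∀ᵐ x : Space N, (x, z.2) ∈ halfSpace N →
      u (x, z.2) = v (x, z.2) :=
    (Measure.quasiMeasurePreserving_snd (μ := (volume : Measure (Space N)))
      (ν := (volume : Measure ℝ))).ae h3
  filter_upwards [h, ae_restrict_of_ae h4, ae_restrict_mem measurableSet_halfSpace]
    with z hz hz4 hzh
  rw [source, source, hz]
  congr 1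
  refine lintegral_congr_ae ?_
  filter_upwards [hz4] with x hx
  rw [hx ⟨mem_univ _, hzh.2⟩]

theorem MemLrLoc.congr_ae {r : ℝ} {u v : SpaceTime N → ℝ} (hu : MemLrLoc r u)
    (h : u =ᵐ[volume.restrict (halfSpace N)] v) : MemLrLoc r v := fun C hC hCh =>
  (hu C hC hCh).ae_eq (ae_restrict_of_ae_restrict_of_subset hCh h)

theorem IsSobolevLoc.congr_ae {u v ut : SpaceTime N → ℝ} {Du : SpaceTime N → Space N}
    (hu : IsSobolevLoc 2 u ut Du) (h : u =ᵐ[volume.restrict (halfSpace N)] v) :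
    IsSobolevLoc 2 v ut Du where
  memLr := hu.memLr.congr_ae h
  memLr_time := hu.memLr_time
  memLr_space := hu.memLr_space
  weak_time φ hφ := by
    rw [← hu.weak_time φ hφ]
    refine integral_congr_ae ?_
    filter_upwards [h] with z hz
    rw [hz]
  weak_space φ hφ := by
    rw [← hu.weak_space φ hφ]
    refine integral_congr_ae ?_
    filter_upwards [h] with z hz
    rw [hz]

theorem IsInteriorTest.isTest {φ : SpaceTime N → ℝ} (hφ : IsInteriorTest φ)
    (h0 : ∀ z, 0 ≤ φ z) : IsTest φ :=
  ⟨hφ.smooth.of_le (by simp), hφ.compact, h0⟩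

theorem le_ofReal_of_coe_le {L : ℝ≥0∞} {r : ℝ} (h : (L : EReal) ≤ (r : EReal)) :
    L ≤ ENNReal.ofReal r := by
  rw [← EReal.coe_ennreal_le_coe_ennreal_iff, EReal.coe_ennreal_ofReal]
  exact h.trans (EReal.coe_le_coe_iff.2 (le_max_left _ _))

/-- Replacing a solution by a measurable nonnegative representative. -/
theorem IsNonnegClassS.exists_isInteriorSolution {K : Space N → ℝ} {p q : ℝ}
    {u ut : SpaceTime N → ℝ} {Du : SpaceTime N → Space N}
    (hu : IsNonnegClassS meanCurvature 2 K p q u ut Du)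
    (hw : ∀ φ, IsInteriorTest φ → (∀ z, 0 ≤ φ z) →
      ∫⁻ z in halfSpace N, source K p q u z * ENNReal.ofReal (φ z) ≤
        ENNReal.ofReal ((∫ z in halfSpace N, ut z * φ z) +
          ∫ z in halfSpace N, inner ℝ (meanCurvature z.1 (u z) (Du z)) (spaceGrad φ z))) :
    ∃ v, IsInteriorSolution K p q v ut Du ∧ u =ᵐ[volume.restrict (halfSpace N)] v := by
  have hm := hu.sobolev.memLr.aestronglyMeasurable
  have hv : u =ᵐ[volume.restrict (halfSpace N)] fun z => max (hm.mk u z) 0 := by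
    filter_upwards [hm.ae_eq_mk, hu.nonneg] with z h1 h2
    -- Truncating a measurable representative at `0` makes it nonnegative everywhere, so `h` and
    -- real powers can be applied without exceptional sets.
    rw [← h1, max_eq_left h2]
  refine ⟨fun z => max (hm.mk u z) 0, ⟨?_, fun z => le_max_right _ _, hu.sobolev.congr_ae hv,
    hu.flux.aestronglyMeasurable, fun φ hφ h0 => ?_⟩, hv⟩
  · exact hm.stronglyMeasurable_mk.measurable.max measurable_const
  · refine (lintegral_congr_ae ?_).trans_le (hw φ hφ h0)
    filter_upwards [source_congr_ae (K := K) (p := p) (q := q) hv] with z hz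
    rw [hz]

end

theorem mainTheorem2 (N : ℕ) (hN : 1 ≤ N) (β p q : ℝ) (hβ₀ : 0 < β) (hβ₁ : β < 1)
    (hp : 0 < p) (hq : 0 < q) (hpq : 2 < p + q)
    (hpq' : p + q ≤ 2 + 2 * (1 - β) / ((N : ℝ) + β))
    (K : Space N → ℝ) (hK : IsAdmissibleKernel β K) :
    (¬ ∃ u : SpaceTime N → ℝ,
      IsNonnegWeakSolution meanCurvature 2 K p q u ∧ IsNontrivial u) ∧
    (¬ ∃ (u₀ : Space N → ℝ) (u : SpaceTime N → ℝ),
      LocallyIntegrable u₀ volume ∧ (∀ᵐ x, 0 ≤ u₀ x) ∧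
      IsNonnegWeakSolutionWithDatum meanCurvature 2 K p q u₀ u ∧ IsNontrivial u) := by
  have key : ∀ {u ut : SpaceTime N → ℝ} {Du : SpaceTime N → Space N},
      IsNonnegClassS meanCurvature 2 K p q u ut Du →
      (∀ φ, IsInteriorTest φ → (∀ z, 0 ≤ φ z) →
        ∫⁻ z in halfSpace N, source K p q u z * ENNReal.ofReal (φ z) ≤
          ENNReal.ofReal ((∫ z in halfSpace N, ut z * φ z) +
            ∫ z in halfSpace N, inner ℝ (meanCurvature z.1 (u z) (Du z)) (spaceGrad φ z))) →
      ¬ IsNontrivial u := fun hu hw hnt => by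
    obtain ⟨v, hv, huv⟩ := hu.exists_isInteriorSolution hw
    refine hnt ?_
    filter_upwards [huv, hv.ae_eq_zero hN hK hβ₀ hp hq hpq hpq'] with z h1 h2
    rw [h1, h2]
  constructor
  · rintro ⟨u, ⟨ut, Du, hu, hw⟩, hnt⟩
    exact key hu (fun φ hφ h0 => le_ofReal_of_coe_le (hw φ (hφ.isTest h0)).2.2) hnt
  · rintro ⟨u₀, u, -, -, ⟨ut, Du, hu, hw⟩, hnt⟩
    refine key hu (fun φ hφ h0 => ?_) hnt
    have h := le_ofReal_of_coe_le (hw φ (hφ.isTest h0)).2.2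
    -- Test functions supported in `t > 0` do not see the datum, and for them the weak time
    -- derivative turns the second formulation into the first.
    have hφ0 : ∀ x : Space N, φ (x, 0) = 0 := fun x =>
      image_eq_zero_of_notMem_tsupport fun hx => lt_irrefl (0 : ℝ) (hφ.support_subset hx).2
    simpa [hφ0, hu.sobolev.weak_time φ hφ] using h
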